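/- Let $d\ge 2$, $n\ge 1$, $\omega=e^{2\pi i/d}$. Let $L$ be a finite set and $\mathcal M$ a collection of subsets of $L$ (contexts); the elements of each context are listed in a fixed order, $C=(a_1,\dots,a_k)$, and each $a\in C$ carries a sign $\epsilon_C(a)\in\{\pm1\}$ (for instance $\epsilon_C(a)=\epsilon(a)$ for a function $\epsilon:L\to\{\pm1\}$). Let $\tau:\mathcal M\to\mathbb Z_d$. An operator realization is a map $T:L\to U(n)$ with $T_a^d=I$ for all $a\in L$ and $T_{a_1}^{\epsilon_C(a_1)}\cdots T_{a_k}^{\epsilon_C(a_k)}=\omega^{\tau(C)}I$ for all $C\in\mathcal M$. A classical realization is a map $c:L\to\mathbb Z_d$ with $\prod_{a\in C}\omega^{\epsilon_C(a)c(a)}=\omega^{\tau(C)}$ for all $C\in\mathcal M$. Let $X_{\mathrm{sing}}$ be the cell complex with a single vertex, one oriented loop for each $a\in L$, and one $2$-cell for each context $C$, attached along $a_1^{\epsilon_C(a_1)}\cdots a_k^{\epsilon_C(a_k)}$ (if $C=\emptyset$, its whole boundary is attached to the vertex). A topological realization is a connected $2$-dimensional cell complex $X$ with oriented edges and with $2$-cells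 attached along closed edge paths, together with a map of cell complexes $X\to X_{\mathrm{sing}}$ which preserves the orientations of edges and the boundary words of $2$-cells and is bijective on edges and on $2$-cells; so each edge of $X$ is labelled by an element of $L$. For an edge path $p$ in $X$ that traverses the edges labelled $b_1,\dots,b_m$ with orientations $\delta_1,\dots,\delta_m\in\{\pm1\}$, the path operator is $T_p=T_{b_1}^{\delta_1}\cdots T_{b_m}^{\delta_m}$ (and $T_p=I$ if $m=0$). Theorem. Let $T:L\to U(n)$ be an operator realization of $(L,\mathcal M,\epsilon,\tau)$, let $X$ be a topological realization of $(L,\mathcal M,\epsilon)$, and let $v$ be a vertex of $X$. Then there is a unique group homomorphism $\pi:\pi_1(X,v)\to U(n)/\langle\omega I\rangle$ with $\pi([p])=[T_p]$ for every edge loop $p$ at $v$, where the product in $\pi_1(X,v)$ is concatenation of loops, $[p][q]=[p\cdot q]$. Moreover, a classical realization of $(L,\mathcal M,\epsilon,\tau)$ exists if and only if $\pi$ lifts to a linear representation, i.e. there is a group homomorphism $\tilde\pi:\pi_1(X,v)\to U(n)$ whose composite with the quotient map $U(n)\to U(n)/\langle\omega I\rangle$ is $\pi$. -/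

import Mathlib

universe u v

/-! ### Signed arrangements and their realizations -/

/-- A signed arrangement on a label set `L`: a finite collection of subsets of `L` (contexts), an
ordering `a₁, …, a_k` of the elements of each context, and a sign `±1` for each label of each
context. A sign function `L → {±1}` is the special case in which `sign C a` is independent
of `C`. -/
structure SignedArrangement (L : Type u) where
  contexts : Finset (Finset L)
  order : {C // C ∈ contexts} → List L
  order_nodup : ∀ C, (order C).Nodup
  mem_order : ∀ C a, a ∈ order C ↔ a ∈ C.1
  sign : {C // C ∈ contexts} → L → ℤˣ

namespace SignedArrangement

/-- The set of contexts, as a type. -/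
abbrev Context {L : Type u} (A : SignedArrangement L) : Type u := {C // C ∈ A.contexts}

end SignedArrangement

/-- `ω = e^{2πi/d}`. -/
noncomputable def rootOmega (d : ℕ) : ℂ := Complex.exp (2 * Real.pi * Complex.I / d)

theorem rootOmega_mem_unitary (d : ℕ) : rootOmega d ∈ unitary ℂ := by
  have h : rootOmega d = Complex.exp (((2 * Real.pi / d : ℝ) : ℂ) * Complex.I) := by
    unfold rootOmega
    congr 1
    push_cast
    ring
  have h1 : ‖rootOmega d‖ = 1 := by rw [h, Complex.norm_exp_ofReal_mul_I]
  have h2 : (starRingEnd ℂ) (rootOmega d) * rootOmega d = 1 := by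
    rw [← Complex.normSq_eq_conj_mul_self, Complex.normSq_eq_norm_sq, h1]
    norm_num
  refine Unitary.mem_iff.2 ⟨h2, ?_⟩
  rw [mul_comm]
  exact h2

/-- The scalar matrix `ω I` in `U(n)`. -/
noncomputable def scalarOmega (d n : ℕ) : Matrix.unitaryGroup (Fin n) ℂ :=
  ⟨Matrix.scalar (Fin n) (rootOmega d), by
    have h := Unitary.mem_iff.1 (rootOmega_mem_unitary d)
    refine Unitary.mem_iff.2 ⟨?_, ?_⟩
    · simp only [Matrix.scalar_apply, Matrix.star_eq_conjTranspose,
        Matrix.diagonal_conjTranspose, Matrix.diagonal_mul_diagonal, Pi.star_apply, h.1,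
        Matrix.diagonal_one]
    · simp only [Matrix.scalar_apply, Matrix.star_eq_conjTranspose,
        Matrix.diagonal_conjTranspose, Matrix.diagonal_mul_diagonal, Pi.star_apply, h.2,
        Matrix.diagonal_one]⟩

theorem scalarOmega_mul_comm (d n : ℕ) (U : Matrix.unitaryGroup (Fin n) ℂ) :
    scalarOmega d n * U = U * scalarOmega d n :=
  Subtype.ext (Matrix.scalar_commute (rootOmega d) (fun r => mul_comm _ r) U.1).eq

/-- The subgroup `⟨ω⟩` of scalar matrices in `U(n)`. -/
noncomputable abbrev omegaSubgroup (d n : ℕ) : Subgroup (Matrix.unitaryGroup (Fin n) ℂ) :=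
  Subgroup.zpowers (scalarOmega d n)

instance omegaSubgroup_normal (d n : ℕ) : (omegaSubgroup d n).Normal where
  conj_mem := by
    rintro x ⟨k, rfl⟩ U
    refine ⟨k, ?_⟩
    have h : Commute (scalarOmega d n) U := scalarOmega_mul_comm d n U
    exact ((h.zpow_left k).symm.mul_inv_cancel).symm

namespace SignedArrangement

variable {L : Type u} (A : SignedArrangement L)

/-- An operator realization: `(T_a)^d = I` for all labels, and
`T_{a₁}^{ε(a₁)} ⋯ T_{a_k}^{ε(a_k)} = ω^{τ(C)} I` for every context `C = {a₁, …, a_k}`. -/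
def IsOperatorRealization {d n : ℕ} (τ : A.Context → ZMod d)
    (T : L → Matrix.unitaryGroup (Fin n) ℂ) : Prop :=
  (∀ a, T a ^ d = 1) ∧
    ∀ C, ((A.order C).map fun a => T a ^ (A.sign C a : ℤ)).prod = scalarOmega d n ^ (τ C).val

/-- A classical realization: `∏_{a ∈ C} ω^{ε(a) c(a)} = ω^{τ(C)}` for every context `C`. -/
def IsClassicalRealization {d : ℕ} (τ : A.Context → ZMod d) (c : L → ZMod d) : Prop :=
  ∀ C : A.Context,
    ∏ a ∈ C.1, rootOmega d ^ (((A.sign C a : ℤ) : ZMod d) * c a).val = rootOmega d ^ (τ C).val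

end SignedArrangement

/-! ### Combinatorial 2-complexes -/

/-- A graph with oriented edges (loops and multiple edges allowed). -/
structure OrientedGraph where
  V : Type u
  E : Type u
  src : E → V
  tgt : E → V

namespace OrientedGraph

/-- Edge paths `v → w`: finite sequences of composable edges, each traversed in its own direction
(`fwd`) or against it (`bwd`). -/
inductive EdgePath (G : OrientedGraph.{u}) : G.V → G.V → Type u
  | nil (x : G.V) : EdgePath G x x
  | fwd (e : G.E) {w : G.V} (p : EdgePath G (G.tgt e) w) : EdgePath G (G.src e) w
  | bwd (e : G.E) {w : G.V} (p : EdgePath G (G.src e) w) : EdgePath G (G.tgt e) w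

/-- The sequence `a₁^{ε₁}, …, a_k^{ε_k}` of edges with orientations traversed by an edge path. -/
def EdgePath.word {G : OrientedGraph.{u}} : {x w : G.V} → G.EdgePath x w → List (G.E × ℤˣ)
  | _, _, .nil _ => []
  | _, _, .fwd e p => (e, 1) :: p.word
  | _, _, .bwd e p => (e, -1) :: p.word

end OrientedGraph

/-- A combinatorial 2-complex: an oriented graph (the 1-skeleton), a set `F` of 2-cells, and for
each 2-cell the closed edge path along which its boundary circle is attached. The boundary path of
length zero attaches the whole boundary circle to a vertex. -/
structure CombinatorialComplex extends OrientedGraph.{u} where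
  F : Type u
  base : F → V
  bdry : (f : F) → toOrientedGraph.EdgePath (base f) (base f)

namespace CombinatorialComplex

variable (K : CombinatorialComplex.{u})

/-- Disjoint union of the closed cells: a point for each vertex, an interval `[0,1]` for each edge,
a closed unit disk for each 2-cell. -/
abbrev Cells : Type u :=
  (Σ _ : K.V, Unit) ⊕ (Σ _ : K.E, unitInterval) ⊕
    (Σ _ : K.F, Metric.closedBall (0 : ℂ) 1)

variable {K}

def vertexCell (x : K.V) : K.Cells := .inl ⟨x, ()⟩
def edgeCell (e : K.E) (t : unitInterval) : K.Cells := .inr (.inl ⟨e, t⟩)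
def faceCell (f : K.F) (z : Metric.closedBall (0 : ℂ) 1) : K.Cells := .inr (.inr ⟨f, z⟩)

/-- The point with parameter `t` on an edge traversed with the given orientation. -/
def signedEdgeCell (a : K.E × ℤˣ) (t : unitInterval) : K.Cells :=
  if a.2 = 1 then edgeCell a.1 t else edgeCell a.1 (unitInterval.symm t)

/-- The attaching maps. The ends of an edge are glued to its source and target. The boundary circle
of a 2-cell whose boundary path has length `k ≥ 1` is cut into `k` arcs of equal length, the `i`-th
of which runs along the `i`-th edge of the path. -/
inductive Glue : K.Cells → K.Cells → Prop
  | src (e : K.E) : Glue (edgeCell e 0) (vertexCell (K.src e))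
  | tgt (e : K.E) : Glue (edgeCell e 1) (vertexCell (K.tgt e))
  | faceConst (f : K.F) (h : (K.bdry f).word = []) (z : Metric.closedBall (0 : ℂ) 1)
      (hz : ‖(z : ℂ)‖ = 1) : Glue (faceCell f z) (vertexCell (K.base f))
  | face (f : K.F) (i : Fin (K.bdry f).word.length) (t : unitInterval)
      (z : Metric.closedBall (0 : ℂ) 1)
      (hz : (z : ℂ) = Complex.exp (2 * Real.pi * Complex.I *
        (((i : ℕ) : ℂ) + ((t : ℝ) : ℂ)) / ((K.bdry f).word.length : ℂ))) :
      Glue (faceCell f z) (signedEdgeCell ((K.bdry f).word.get i) t)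

variable (K)

/-- The cell complex as a topological space: the quotient of the disjoint union of the cells by
the attaching maps. -/
def Space : Type u := Quot (Glue (K := K))

instance : TopologicalSpace K.Space := inferInstanceAs (TopologicalSpace (Quot (Glue (K := K))))

variable {K}

/-- A vertex as a point of the space. -/
def pt (x : K.V) : K.Space := Quot.mk _ (vertexCell x)

/-- An edge, as a path in the space from its source to its target. -/
def edgePath (e : K.E) : Path (pt (K.src e)) (pt (K.tgt e)) where
  toFun t := Quot.mk _ (edgeCell e t)
  continuous_toFun := by
    refine continuous_quot_mk.comp ?_
    unfold edgeCell
    exact continuous_inr.comp (continuous_inl.comp continuous_sigmaMk)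
  source' := Quot.sound (.src e)
  target' := Quot.sound (.tgt e)

/-- The path in the space which traverses the edges of an edge path in order. -/
noncomputable def realizePath : {x w : K.V} → K.EdgePath x w → Path (pt x) (pt w)
  | _, _, .nil x => Path.refl (pt x)
  | _, _, .fwd e p => (edgePath e).trans (realizePath p)
  | _, _, .bwd e p => (edgePath e).symm.trans (realizePath p)

end CombinatorialComplex

/-- A map of cell complexes which maps every open cell homeomorphically onto a cell of the same
dimension, compatibly with the orientations of the edges and the chosen parametrizations of the
2-cells: it is given by maps of vertices, edges and 2-cells which respect all attaching maps. -/
structure CombinatorialMap (K : CombinatorialComplex.{u}) (K' : CombinatorialComplex.{v}) where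
  onV : K.V → K'.V
  onE : K.E → K'.E
  onF : K.F → K'.F
  map_src : ∀ e, onV (K.src e) = K'.src (onE e)
  map_tgt : ∀ e, onV (K.tgt e) = K'.tgt (onE e)
  map_base : ∀ f, onV (K.base f) = K'.base (onF f)
  map_bdry : ∀ f, (K'.bdry (onF f)).word = (K.bdry f).word.map fun a => (onE a.1, a.2)

/-- The fundamental group of `X` at `x`, in the convention where `[p] * [q]` is the class of the
loop that traverses `p` first and then `q`. (Mathlib's `FundamentalGroup` multiplies in the
opposite order.) -/
abbrev PiOne (X : Type u) [TopologicalSpace X] (x : X) : Type u := (FundamentalGroup X x)ᵐᵒᵖ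

/-- The homotopy class of a loop. -/
def PiOne.mk {X : Type u} [TopologicalSpace X] {x : X} (p : Path x x) : PiOne X x :=
  MulOpposite.op (FundamentalGroup.fromPath (Path.Homotopic.Quotient.mk p))

theorem PiOne.mk_mul_mk {X : Type u} [TopologicalSpace X] {x : X} (p q : Path x x) :
    PiOne.mk p * PiOne.mk q = PiOne.mk (p.trans q) := rfl

/-! ### Topological realizations of arrangements -/

namespace SignedArrangement

variable {L : Type u} (A : SignedArrangement L)

/-- One vertex, and a loop at it for each label. -/
def singGraph : OrientedGraph.{u} where
  V := PUnit
  E := L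
  src _ := PUnit.unit
  tgt _ := PUnit.unit

/-- In the one-vertex graph every sequence of signed labels is a closed edge path. -/
def singPath : List (L × ℤˣ) → (singGraph (L := L)).EdgePath PUnit.unit PUnit.unit
  | [] => .nil (G := singGraph) PUnit.unit
  | a :: l => if a.2 = 1 then .fwd (G := singGraph) a.1 (singPath l)
      else .bwd (G := singGraph) a.1 (singPath l)

theorem word_singPath (l : List (L × ℤˣ)) : (singPath l).word = l := by
  induction l with
  | nil => rfl
  | cons a l ih =>
    obtain ⟨a, s⟩ := a
    rcases Int.units_eq_one_or s with rfl | rfl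
    · simp only [singPath]
      exact congrArg _ ih
    · simp only [singPath]
      exact congrArg _ ih

/-- The complex `X_sing` of an arrangement: a single vertex, a loop for each label, and for each
context `C = {a₁, …, a_k}` a disk attached along `a₁^{ε(a₁)} ⋯ a_k^{ε(a_k)}`. -/
def sing : CombinatorialComplex.{u} where
  toOrientedGraph := singGraph (L := L)
  F := A.Context
  base _ := PUnit.unit
  bdry C := singPath ((A.order C).map fun a => (a, A.sign C a))

/-- A topological realization: a connected 2-dimensional cell complex with a map to `X_sing` which
is bijective on edges and on 2-cells. -/
structure TopologicalRealization where
  complex : CombinatorialComplex.{v}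
  connected : ConnectedSpace complex.Space
  toSing : CombinatorialMap complex A.sing
  bijective_onE : Function.Bijective toSing.onE
  bijective_onF : Function.Bijective toSing.onF

namespace TopologicalRealization

variable {A} (X : A.TopologicalRealization)

/-- The label of an edge. -/
def label (e : X.complex.E) : L := X.toSing.onE e

/-- The path operator `T_p = T_{a₁}^{ε₁} ⋯ T_{a_k}^{ε_k}` of an edge path `p`. -/
def pathOperator {n : ℕ} (T : L → Matrix.unitaryGroup (Fin n) ℂ) {x w : X.complex.V}
    (p : X.complex.EdgePath x w) : Matrix.unitaryGroup (Fin n) ℂ :=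
  (p.word.map fun a => T (X.label a.1) ^ (a.2 : ℤ)).prod

/-- The fundamental group of the underlying space at a vertex. -/
abbrev fundGroup (x : X.complex.V) : Type _ :=
  PiOne X.complex.Space (CombinatorialComplex.pt x)

/-- `π` is the projective representation `[p] ↦ [T_p]`, for edge loops `p` at the base vertex. -/
def IsInducedRep (d : ℕ) {n : ℕ} (T : L → Matrix.unitaryGroup (Fin n) ℂ) (x : X.complex.V)
    (π : X.fundGroup x →* Matrix.unitaryGroup (Fin n) ℂ ⧸ omegaSubgroup d n) : Prop :=
  ∀ p : X.complex.EdgePath x x,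
    π (PiOne.mk (CombinatorialComplex.realizePath p)) =
      QuotientGroup.mk' (omegaSubgroup d n) (X.pathOperator T p)

end TopologicalRealization

end SignedArrangement

/-! The theorem rests on how edge paths and 2-cells control the fundamental group of a 2-complex,
proved here for the quotient space itself.

First, group elements `φ e` on the edges whose product around every 2-cell is trivial define a
homomorphism on π₁ that sends an edge loop to its product (`exists_holonomy`). They define a flat
principal bundle with discrete fiber: its local flat sections exist around every point because the
holonomy around each disk is trivial (`exists_isFlat`). The bundle is a covering, and the
homomorphism is its monodromy, which commutes with right multiplication on the fiber.

Secondly, every path between vertices is homotopic to an edge path (`exists_edgeClass`). The classes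
of paths that run along edges and then inside one closed cell form a well-defined set over each
point. This set is preserved by every short path, since small neighbourhoods contract along tracks
that stay in closed cells; subdivision gives all paths. Thirdly, the boundary of a 2-cell is
null-homotopic (`edgeClass_bdry`).

Modulo ω the operators multiply to 1 around each 2-cell, so the first fact gives π and the second
its uniqueness. A classical realization c makes the operators ω^{-c(a)} T_a multiply to 1 around
each 2-cell exactly, and their holonomy lifts π. Conversely, given a lift ρ, choose edge paths t_v
from the base vertex to all vertices v. For an edge e from v to w put θ(e) = T_{t_v}⁻¹ ρ([t_v e
t_w⁻¹]) T_{t_w}. Modulo ω this telescopes to T_e, so θ(e) = ω^{k(e)} T_e. By the third fact θ is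
trivial around every 2-cell. Comparing with the context relations, the signed sum of k over C is
-τ(C), and c = -k is a classical realization. -/

open unitInterval

namespace CombinatorialComplex

/-! ### Polar coordinates on the unit disk -/

/-- The point with radius `ρ` and angle `2π (i + t) / k` of the closed unit disk. -/
noncomputable def polar (k i : ℕ) (ρ t : I) : Metric.closedBall (0 : ℂ) 1 :=
  ⟨((ρ : ℝ) : ℂ) * Complex.exp (2 * Real.pi * Complex.I * ((i : ℂ) + ((t : ℝ) : ℂ)) / (k : ℂ)), by
    have h : 2 * Real.pi * Complex.I * ((i : ℂ) + ((t : ℝ) : ℂ)) / (k : ℂ)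
        = ((2 * Real.pi * (i + t) / k : ℝ) : ℂ) * Complex.I := by
      push_cast
      ring
    rw [mem_closedBall_zero_iff, norm_mul, h, Complex.norm_exp_ofReal_mul_I, mul_one,
      Complex.norm_real, Real.norm_eq_abs, abs_of_nonneg ρ.2.1]
    exact ρ.2.2⟩

theorem polar_eq (k i : ℕ) (ρ t : I) : (polar k i ρ t : ℂ) =
    ((ρ : ℝ) : ℂ) * Complex.exp (((2 * Real.pi * ((i + t) / k) : ℝ) : ℂ) * Complex.I) := by
  simp only [polar]
  congr 2
  push_cast
  ring

theorem norm_polar (k i : ℕ) (ρ t : I) : ‖(polar k i ρ t : ℂ)‖ = ρ := by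
  rw [polar_eq, norm_mul, Complex.norm_exp_ofReal_mul_I, mul_one, Complex.norm_real,
    Real.norm_eq_abs, abs_of_nonneg ρ.2.1]

theorem continuous_polar (k i : ℕ) : Continuous fun p : I × I => polar k i p.1 p.2 := by
  refine Continuous.subtype_mk ?_ _
  fun_prop

/-- Normalize the argument to [0, 2π) and rescale it to y in [0, k). The sector is the integer part
of y, and the position in the sector is its fractional part. -/
theorem polar_surjective {k : ℕ} (hk : 0 < k) (z : Metric.closedBall (0 : ℂ) 1) :
    ∃ i < k, ∃ ρ t : I, polar k i ρ t = z := by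
  have hk' : (0 : ℝ) < k := by exact_mod_cast hk
  set θ : ℝ := toIcoMod Real.two_pi_pos 0 (Complex.arg z) with hθ
  have hθm := toIcoMod_mem_Ico Real.two_pi_pos 0 (Complex.arg z)
  rw [← hθ, zero_add] at hθm
  set y : ℝ := θ / (2 * Real.pi) * k with hy
  have hy0 : 0 ≤ y := by have := hθm.1; have := Real.pi_pos; positivity
  have hyk : y < k := by
    rw [hy]
    have : θ / (2 * Real.pi) < 1 := by rw [div_lt_one Real.two_pi_pos]; exact hθm.2
    nlinarith
  refine ⟨⌊y⌋₊, (Nat.floor_lt hy0).2 hyk, ⟨‖(z : ℂ)‖, norm_nonneg _, mem_closedBall_zero_iff.1 z.2⟩,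
    ⟨y - ⌊y⌋₊, sub_nonneg.2 (Nat.floor_le hy0), by linarith [Nat.lt_floor_add_one y]⟩, ?_⟩
  apply Subtype.ext
  rw [polar_eq]
  have h1 : 2 * Real.pi * ((⌊y⌋₊ + (y - ⌊y⌋₊)) / k) = θ := by
    rw [hy]; field_simp; ring
  simp only [h1]
  have h2 : Complex.exp ((θ : ℂ) * Complex.I) = Complex.exp ((Complex.arg z : ℂ) * Complex.I) := by
    rw [Complex.exp_eq_exp_iff_exists_int]
    refine ⟨-toIcoDiv Real.two_pi_pos 0 (Complex.arg z), ?_⟩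
    rw [hθ, toIcoMod]
    simp only [zsmul_eq_mul]
    push_cast
    ring
  rw [h2]
  exact Complex.norm_mul_exp_arg_mul_I z

theorem polar_one_eq_zero {k : ℕ} (hk : 0 < k) {i : ℕ} (hi : i < k) (ρ : I) :
    polar k i ρ 1 = polar k ((i + 1) % k) ρ 0 := by
  apply Subtype.ext
  rw [polar_eq, polar_eq]
  congr 1
  rw [Complex.exp_eq_exp_iff_exists_int]
  have hk' : (k : ℂ) ≠ 0 := by exact_mod_cast hk.ne'
  rcases Nat.lt_or_ge (i + 1) k with h | h
  · refine ⟨0, ?_⟩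
    rw [Nat.mod_eq_of_lt h]
    push_cast
    simp
  · obtain rfl : i + 1 = k := by omega
    refine ⟨1, ?_⟩
    rw [Nat.mod_self]
    push_cast at hk' ⊢
    field_simp
    simp

theorem polar_eq_polar {k : ℕ} (hk : 0 < k) {i j : ℕ} (hi : i < k) (hj : j < k) {ρ ρ' t t' : I}
    (h : polar k i ρ t = polar k j ρ' t') :
    ρ = ρ' ∧ (ρ = 0 ∨ (i = j ∧ t = t') ∨ (t = 1 ∧ t' = 0 ∧ j = (i + 1) % k) ∨
      (t' = 1 ∧ t = 0 ∧ i = (j + 1) % k)) := by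
  have hk' : (0 : ℝ) < k := by exact_mod_cast hk
  have hρ : ρ = ρ' := by
    apply Subtype.ext
    rw [← norm_polar k i ρ t, ← norm_polar k j ρ' t', h]
  subst hρ
  refine ⟨rfl, ?_⟩
  by_cases h0 : ρ = 0
  · exact Or.inl h0
  right
  have hρ0 : ((ρ : ℝ) : ℂ) ≠ 0 := by
    intro h'
    exact h0 (Subtype.ext (by exact_mod_cast h'))
  have h1 := congrArg Subtype.val h
  rw [polar_eq, polar_eq] at h1
  have h2 := mul_left_cancel₀ hρ0 h1
  rw [Complex.exp_eq_exp_iff_exists_int] at h2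
  obtain ⟨n, hn⟩ := h2
  have h3 : ((i : ℝ) + t) = j + t' + n * k := by
    have h4 : ((2 * Real.pi * ((i + t) / k) : ℝ) : ℂ) =
        ((2 * Real.pi * ((j + t') / k) + n * (2 * Real.pi) : ℝ) : ℂ) := by
      apply mul_right_cancel₀ Complex.I_ne_zero
      rw [hn]
      push_cast
      ring
    have h5 := Complex.ofReal_injective h4
    have hpi := Real.pi_pos
    field_simp at h5
    linarith
  have ht0 := t.2.1
  have ht1 := t.2.2
  have ht0' := t'.2.1
  have ht1' := t'.2.2
  have hi' : (i : ℝ) + 1 ≤ k := by exact_mod_cast hi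
  have hj' : (j : ℝ) + 1 ≤ k := by exact_mod_cast hj
  have hi0 : (0 : ℝ) ≤ i := by positivity
  have hj0 : (0 : ℝ) ≤ j := by positivity
  -- Equality of angles modulo a full turn makes this integer equal to t' - t, which lies in [-1,
  -- 1]. Its three possible values are the three alternatives: the same ray, or the common ray of
  -- two consecutive sectors in either order.
  obtain ⟨m, hm⟩ : ∃ m : ℤ, m = (i : ℤ) - j - n * k := ⟨_, rfl⟩
  have hmr : (m : ℝ) = t' - t := by rw [hm]; push_cast; linarith
  have hm1 : m ≤ 1 := by
    have : (m : ℝ) ≤ 1 := by linarith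
    exact_mod_cast this
  have hm2 : -1 ≤ m := by
    have : (-1 : ℝ) ≤ m := by linarith
    exact_mod_cast this
  have hkz : (0 : ℤ) < k := by exact_mod_cast hk
  have hmod : ∀ a b : ℕ, a < k → b < k → ∀ s : ℤ, (a : ℤ) = b + s * k → a = b := by
    intro a b ha hb s hs
    have hs0 : s = 0 := by
      have h1 : s < 1 := by
        by_contra hc
        push Not at hc
        nlinarith
      have h2 : -1 < s := by
        by_contra hc
        push Not at hc
        nlinarith
      omega
    rw [hs0] at hs
    omega
  have hsucc : ∀ a : ℕ, ∃ s : ℤ, (((a + 1) % k : ℕ) : ℤ) = a + 1 + s * k := by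
    intro a
    refine ⟨-((a + 1) / k : ℕ), ?_⟩
    have := Nat.div_add_mod (a + 1) k
    have h' : ((k * ((a + 1) / k) + (a + 1) % k : ℕ) : ℤ) = ((a + 1 : ℕ) : ℤ) := by rw [this]
    push_cast at h' ⊢
    linarith
  rcases (by omega : m = 0 ∨ m = -1 ∨ m = 1) with h | h | h
  · left
    refine ⟨hmod i j hi hj n (by linarith), Subtype.ext ?_⟩
    rw [h] at hmr
    push_cast at hmr
    linarith
  · right; left
    rw [h] at hmr
    push_cast at hmr
    refine ⟨Subtype.ext (show (t : ℝ) = 1 by linarith),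
      Subtype.ext (show (t' : ℝ) = 0 by linarith), ?_⟩
    obtain ⟨s, hs⟩ := hsucc i
    refine hmod _ _ hj (Nat.mod_lt _ hk) (-n - s) ?_
    rw [hs]
    linarith
  · right; right
    rw [h] at hmr
    push_cast at hmr
    refine ⟨Subtype.ext (show (t' : ℝ) = 1 by linarith),
      Subtype.ext (show (t : ℝ) = 0 by linarith), ?_⟩
    obtain ⟨s, hs⟩ := hsucc j
    refine hmod _ _ hi (Nat.mod_lt _ hk) (n - s) ?_
    rw [hs]
    linarith

/-- A function of polar coordinates which is compatible with the identifications descends to the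
disk. -/
theorem exists_polar_lift {Z : Type*} {k : ℕ} (hk : 0 < k) (g : ℕ → I → I → Z)
    (hrad : ∀ i < k, ∀ ρ, g i ρ 1 = g ((i + 1) % k) ρ 0)
    (hcen : ∀ i < k, ∀ t, g i 0 t = g i 0 0) :
    ∃ h : Metric.closedBall (0 : ℂ) 1 → Z, ∀ i < k, ∀ ρ t, h (polar k i ρ t) = g i ρ t := by
  choose ci hci cρ ct hc using polar_surjective hk
  refine ⟨fun z => g (ci z) (cρ z) (ct z), fun i hi ρ t => ?_⟩
  -- At radius 0 the value is constant within a sector and agrees on common rays, hence is the same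
  -- in all sectors.
  have hz : ∀ i < k, ∀ t, g i 0 t = g 0 0 0 := by
    intro i
    induction i with
    | zero => intro hi t; exact hcen 0 hi t
    | succ i ih =>
      intro hi t
      rw [hcen _ hi, ← ih (by omega) 1, hrad i (by omega), Nat.mod_eq_of_lt hi]
  dsimp only
  obtain ⟨h1, h2⟩ := polar_eq_polar hk (hci _) hi (hc (polar k i ρ t))
  have hci' := hci (polar k i ρ t)
  generalize ci (polar k i ρ t) = j at *
  generalize ct (polar k i ρ t) = t' at *
  rw [h1] at h2 ⊢
  rcases h2 with h2 | ⟨h2, h3⟩ | ⟨h2, h3, h4⟩ | ⟨h2, h3, h4⟩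
  · rw [h2, hz _ hci', hz _ hi]
  · rw [h2, h3]
  · rw [h2, h3, hrad _ hci', ← h4]
  · rw [h2, h3, hrad _ hi, ← h4]

/-- Finitely many squares form a compact space mapping continuously onto the Hausdorff disk, so
polar coordinates are a quotient map. -/
theorem isOpen_of_polar {k : ℕ} (hk : 0 < k) {S : Set (Metric.closedBall (0 : ℂ) 1)}
    (h : ∀ i < k, IsOpen {p : I × I | polar k i p.1 p.2 ∈ S}) : IsOpen S := by
  let m : (Σ _ : Fin k, I × I) → Metric.closedBall (0 : ℂ) 1 := fun p => polar k p.1 p.2.1 p.2.2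
  have hm : Continuous m := continuous_sigma fun i => continuous_polar k i
  have hs : Function.Surjective m := by
    intro z
    obtain ⟨i, hi, ρ, t, h⟩ := polar_surjective hk z
    exact ⟨⟨⟨i, hi⟩, ρ, t⟩, h⟩
  have hq : Topology.IsQuotientMap m := hm.isClosedMap.isQuotientMap hm hs
  rw [← hq.isOpen_preimage, isOpen_sigma_iff]
  exact fun i => h i i.2

end CombinatorialComplex

/-! ### Vertices along an edge path -/

namespace OrientedGraph

variable {G : OrientedGraph.{u}}

/-- The starting vertex of an edge traversed with the given orientation. -/
def start (a : G.E × ℤˣ) : G.V := if a.2 = 1 then G.src a.1 else G.tgt a.1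

/-- The final vertex of an edge traversed with the given orientation. -/
def finish (a : G.E × ℤˣ) : G.V := if a.2 = 1 then G.tgt a.1 else G.src a.1

namespace EdgePath

/-- The `i`-th vertex visited by an edge path (constant after the end of the path). -/
def vert : {x w : G.V} → G.EdgePath x w → ℕ → G.V
  | _, _, .nil x, _ => x
  | _, _, .fwd e _, 0 => G.src e
  | _, _, .fwd _ p, i + 1 => p.vert i
  | _, _, .bwd e _, 0 => G.tgt e
  | _, _, .bwd _ p, i + 1 => p.vert i

theorem vert_zero {x w : G.V} (p : G.EdgePath x w) : p.vert 0 = x := by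
  cases p <;> rfl

theorem vert_length {x w : G.V} (p : G.EdgePath x w) : p.vert p.word.length = w := by
  induction p with
  | nil x => rfl
  | fwd e p ih => exact ih
  | bwd e p ih => exact ih

theorem vert_of_word_eq_nil {x w : G.V} (p : G.EdgePath x w) (h : p.word = []) (i : ℕ) :
    p.vert i = x := by
  cases p with
  | nil x => rfl
  | fwd e p => simp [word] at h
  | bwd e p => simp [word] at h

theorem start_word {x w : G.V} (p : G.EdgePath x w) (i : ℕ) (hi : i < p.word.length) :
    start p.word[i] = p.vert i := by
  induction p generalizing i with
  | nil x => simp [word] at hi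
  | fwd e p ih =>
    cases i with
    | zero => rfl
    | succ i => exact ih i (Nat.lt_of_succ_lt_succ hi)
  | bwd e p ih =>
    cases i with
    | zero => rfl
    | succ i => exact ih i (Nat.lt_of_succ_lt_succ hi)

theorem finish_word {x w : G.V} (p : G.EdgePath x w) (i : ℕ) (hi : i < p.word.length) :
    finish p.word[i] = p.vert (i + 1) := by
  induction p generalizing i with
  | nil x => simp [word] at hi
  | fwd e p ih =>
    cases i with
    | zero => exact (vert_zero p).symm
    | succ i => exact ih i (Nat.lt_of_succ_lt_succ hi)
  | bwd e p ih =>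
    cases i with
    | zero => exact (vert_zero p).symm
    | succ i => exact ih i (Nat.lt_of_succ_lt_succ hi)

end EdgePath

end OrientedGraph

namespace CombinatorialComplex

variable {K : CombinatorialComplex.{u}}

/-! ### The space of a complex in polar coordinates -/

/-- The number of arcs into which the boundary circle of a 2-cell is cut. -/
def numArcs (f : K.F) : ℕ := max 1 (K.bdry f).word.length

theorem numArcs_pos (f : K.F) : 0 < numArcs f := lt_of_lt_of_le one_pos (le_max_left _ _)

theorem numArcs_eq {f : K.F} (h : 0 < (K.bdry f).word.length) :
    numArcs f = (K.bdry f).word.length := max_eq_right h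

/-- A point of an edge. -/
def edgePt (e : K.E) (t : I) : K.Space := Quot.mk _ (edgeCell e t)

/-- A point of a 2-cell in polar coordinates. -/
noncomputable def facePt (f : K.F) (i : ℕ) (ρ t : I) : K.Space :=
  Quot.mk _ (faceCell f (polar (numArcs f) i ρ t))

/-- The values along the `i`-th arc of the boundary of a 2-cell of a function given on vertices and
edges. -/
def arcVal {Z : Type*} (zV : K.V → Z) (zE : K.E → I → Z) (f : K.F) (i : ℕ) (t : I) : Z :=
  if h : i < (K.bdry f).word.length then
    if (K.bdry f).word[i].2 = 1 then zE (K.bdry f).word[i].1 t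
    else zE (K.bdry f).word[i].1 (σ t)
  else zV (K.base f)

/-- The `i`-th vertex on the boundary of a 2-cell. -/
def corner (f : K.F) (i : ℕ) : K.V := (K.bdry f).vert i

/-- An empty boundary path still counts as one arc, on which `arcVal` has its default value at the
base vertex. This is the last case, and it lets later arguments treat collapsed boundaries
uniformly. -/
theorem arcVal_zero {Z : Type*} {zV : K.V → Z} {zE : K.E → I → Z}
    (hs : ∀ e, zE e 0 = zV (K.src e)) (ht : ∀ e, zE e 1 = zV (K.tgt e)) (f : K.F) {i : ℕ}
    (hi : i < numArcs f) : arcVal zV zE f i 0 = zV (corner f i) := by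
  unfold arcVal corner
  split_ifs with h h1
  · rw [← OrientedGraph.EdgePath.start_word _ _ h, OrientedGraph.start, if_pos h1, hs]
  · rw [← OrientedGraph.EdgePath.start_word _ _ h, OrientedGraph.start, if_neg h1, symm_zero, ht]
  · rw [OrientedGraph.EdgePath.vert_of_word_eq_nil]
    apply List.eq_nil_of_length_eq_zero
    by_contra h0
    rw [numArcs_eq (Nat.pos_of_ne_zero h0)] at hi
    exact h hi

theorem arcVal_one {Z : Type*} {zV : K.V → Z} {zE : K.E → I → Z}
    (hs : ∀ e, zE e 0 = zV (K.src e)) (ht : ∀ e, zE e 1 = zV (K.tgt e)) (f : K.F) {i : ℕ}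
    (hi : i < numArcs f) : arcVal zV zE f i 1 = zV (corner f (i + 1)) := by
  unfold arcVal corner
  split_ifs with h h1
  · rw [← OrientedGraph.EdgePath.finish_word _ _ h, OrientedGraph.finish, if_pos h1, ht]
  · rw [← OrientedGraph.EdgePath.finish_word _ _ h, OrientedGraph.finish, if_neg h1, symm_one, hs]
  · rw [OrientedGraph.EdgePath.vert_of_word_eq_nil]
    apply List.eq_nil_of_length_eq_zero
    by_contra h0
    rw [numArcs_eq (Nat.pos_of_ne_zero h0)] at hi
    exact h hi

/-- The boundary path is closed, so the corner after the last arc is the first one. -/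
theorem corner_succ_mod (f : K.F) {i : ℕ} (hi : i < numArcs f) :
    corner f ((i + 1) % numArcs f) = corner f (i + 1) := by
  rcases Nat.lt_or_ge (i + 1) (numArcs f) with h | h
  · rw [Nat.mod_eq_of_lt h]
  · have h1 : i + 1 = numArcs f := le_antisymm hi h
    rw [h1, Nat.mod_self]
    unfold corner
    rw [OrientedGraph.EdgePath.vert_zero]
    rcases Nat.eq_zero_or_pos (K.bdry f).word.length with h0 | h0
    · rw [OrientedGraph.EdgePath.vert_of_word_eq_nil _ (List.eq_nil_of_length_eq_zero h0)]
    · rw [numArcs_eq h0, OrientedGraph.EdgePath.vert_length]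

theorem arcVal_one_eq_zero {Z : Type*} {zV : K.V → Z} {zE : K.E → I → Z}
    (hs : ∀ e, zE e 0 = zV (K.src e)) (ht : ∀ e, zE e 1 = zV (K.tgt e)) (f : K.F) {i : ℕ}
    (hi : i < numArcs f) : arcVal zV zE f i 1 = arcVal zV zE f ((i + 1) % numArcs f) 0 := by
  rw [arcVal_one hs ht f hi, arcVal_zero hs ht f (Nat.mod_lt _ (numArcs_pos f)),
    corner_succ_mod f hi]

theorem arcVal_comp {Z Z' : Type*} (g : Z → Z') (zV : K.V → Z) (zE : K.E → I → Z) (f : K.F) (i : ℕ)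
    (t : I) : arcVal (fun v => g (zV v)) (fun e t => g (zE e t)) f i t
      = g (arcVal zV zE f i t) := by
  unfold arcVal
  split_ifs <;> rfl

theorem edgePt_zero (e : K.E) : edgePt e 0 = pt (K.src e) := Quot.sound (.src e)

theorem edgePt_one (e : K.E) : edgePt e 1 = pt (K.tgt e) := Quot.sound (.tgt e)

theorem facePt_one (f : K.F) {i : ℕ} (hi : i < numArcs f) (t : I) :
    facePt f i 1 t = arcVal pt edgePt f i t := by
  by_cases h : i < (K.bdry f).word.length
  · have h2 : facePt f i 1 t = Quot.mk _ (signedEdgeCell ((K.bdry f).word.get ⟨i, h⟩) t) := by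
      refine Quot.sound (Glue.face f ⟨i, h⟩ t _ ?_)
      simp [polar, numArcs_eq (Nat.zero_lt_of_lt h)]
    rw [h2, arcVal, dif_pos h]
    simp only [signedEdgeCell, List.get_eq_getElem]
    split_ifs <;> rfl
  · rw [arcVal, dif_neg h]
    refine Quot.sound (Glue.faceConst f ?_ _ (by rw [norm_polar]; rfl))
    apply List.eq_nil_of_length_eq_zero
    by_contra h0
    rw [numArcs_eq (Nat.pos_of_ne_zero h0)] at hi
    exact h hi

theorem facePt_rad (f : K.F) {i : ℕ} (hi : i < numArcs f) (ρ : I) :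
    facePt f i ρ 1 = facePt f ((i + 1) % numArcs f) ρ 0 := by
  unfold facePt
  rw [polar_one_eq_zero (numArcs_pos f) hi]

theorem facePt_zero (f : K.F) (i j : ℕ) (t t' : I) : facePt f i 0 t = facePt f j 0 t' := by
  unfold facePt
  congr 2
  apply Subtype.ext
  simp [polar]

/-- Compatibility of functions given on vertices, edges and 2-cells with the attaching maps. -/
structure Compatible {Z : Type*} (zV : K.V → Z) (zE : K.E → I → Z) (zF : K.F → ℕ → I → I → Z) :
    Prop where
  src : ∀ e, zE e 0 = zV (K.src e)
  tgt : ∀ e, zE e 1 = zV (K.tgt e)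
  bdry : ∀ f, ∀ i < numArcs f, ∀ t, zF f i 1 t = arcVal zV zE f i t
  rad : ∀ f, ∀ i < numArcs f, ∀ ρ, zF f i ρ 1 = zF f ((i + 1) % numArcs f) ρ 0
  cen : ∀ f, ∀ i < numArcs f, ∀ t, zF f i 0 t = zF f i 0 0

/-- Compatible functions on the cells define a function on the space. -/
theorem Compatible.exists_lift {Z : Type*} {zV : K.V → Z} {zE : K.E → I → Z}
    {zF : K.F → ℕ → I → I → Z} (h : Compatible zV zE zF) :
    ∃ g : K.Space → Z, (∀ v, g (pt v) = zV v) ∧ (∀ e t, g (edgePt e t) = zE e t) ∧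
      ∀ f, ∀ i < numArcs f, ∀ ρ t, g (facePt f i ρ t) = zF f i ρ t := by
  choose gF hgF using fun f => exists_polar_lift (numArcs_pos f) (zF f) (h.rad f) (h.cen f)
  let g0 : K.Cells → Z := fun c => match c with
    | .inl ⟨v, _⟩ => zV v
    | .inr (.inl ⟨e, t⟩) => zE e t
    | .inr (.inr ⟨f, z⟩) => gF f z
  have hg0 : ∀ a b, Glue a b → g0 a = g0 b := by
    intro a b hab
    cases hab with
    | src e => exact h.src e
    | tgt e => exact h.tgt e
    | faceConst f hf z hz =>
      obtain ⟨i, hi, ρ, t, rfl⟩ := polar_surjective (numArcs_pos f) z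
      rw [norm_polar] at hz
      obtain rfl : ρ = 1 := Subtype.ext hz
      refine (hgF f i hi 1 t).trans ?_
      rw [h.bdry f i hi, arcVal, dif_neg (by simp [hf])]
      rfl
    | face f i t z hz =>
      have hn := numArcs_eq (Nat.zero_lt_of_lt i.2)
      obtain rfl : z = polar (numArcs f) i 1 t := by
        apply Subtype.ext
        rw [hz, hn]
        simp [polar]
      have hi : (i : ℕ) < numArcs f := by rw [hn]; exact i.2
      refine (hgF f i hi 1 t).trans ?_
      rw [h.bdry f i hi, arcVal, dif_pos i.2]
      simp only [signedEdgeCell, List.get_eq_getElem]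
      split_ifs <;> rfl
  refine ⟨Quot.lift g0 hg0, fun v => rfl, fun e t => rfl, fun f i hi ρ t => hgF f i hi ρ t⟩

theorem Space.cases (y : K.Space) : (∃ v, y = pt v) ∨ (∃ e t, y = edgePt e t) ∨
    ∃ f, ∃ i < numArcs f, ∃ ρ t, y = facePt f i ρ t := by
  induction y using Quot.ind with
  | _ c =>
    rcases c with ⟨v, ⟨⟩⟩ | ⟨e, t⟩ | ⟨f, z⟩
    · exact .inl ⟨v, rfl⟩
    · exact .inr (.inl ⟨e, t, rfl⟩)
    · obtain ⟨i, hi, ρ, t, rfl⟩ := polar_surjective (numArcs_pos f) z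
      exact .inr (.inr ⟨f, i, hi, ρ, t, rfl⟩)

theorem continuous_edgePt (e : K.E) : Continuous (edgePt e) := (edgePath e).continuous

theorem continuous_facePt (f : K.F) (i : ℕ) : Continuous fun p : I × I => facePt f i p.1 p.2 := by
  refine continuous_quot_mk.comp ?_
  unfold faceCell
  exact continuous_inr.comp (continuous_inr.comp (continuous_sigmaMk.comp (continuous_polar _ i)))

/-- The topology is the quotient topology, and disks may be replaced by their polar squares.
Vertices are discrete and impose no condition. -/
theorem isOpen_space {U : Set K.Space} (hE : ∀ e, IsOpen {t | edgePt e t ∈ U})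
    (hF : ∀ f, ∀ i < numArcs f, IsOpen {p : I × I | facePt f i p.1 p.2 ∈ U}) : IsOpen U := by
  change IsOpen (Quot.mk _ ⁻¹' U)
  rw [isOpen_sum_iff, isOpen_sum_iff]
  simp only [isOpen_sigma_iff]
  refine ⟨fun v => isOpen_discrete _, hE, fun f => isOpen_of_polar (numArcs_pos f) (hF f)⟩

theorem continuousOn_space {Z : Type*} [TopologicalSpace Z] {U : Set K.Space} (hU : IsOpen U)
    {g : K.Space → Z} (hE : ∀ e, ContinuousOn (fun t => g (edgePt e t)) {t | edgePt e t ∈ U})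
    (hF : ∀ f, ∀ i < numArcs f, ContinuousOn (fun p : I × I => g (facePt f i p.1 p.2))
      {p : I × I | facePt f i p.1 p.2 ∈ U}) : ContinuousOn g U := by
  rw [continuousOn_open_iff hU]
  intro W hW
  refine isOpen_space (fun e => ?_) (fun f i hi => ?_)
  · exact (hE e).isOpen_inter_preimage (hU.preimage (continuous_edgePt e)) hW
  · exact (hF f i hi).isOpen_inter_preimage (hU.preimage (continuous_facePt f i)) hW

theorem continuousOn_arcVal {Z : Type*} [TopologicalSpace Z] {zV : K.V → Z} {zE : K.E → I → Z}
    {sV : K.V → Prop} {sE : K.E → I → Prop}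
    (h : ∀ e, ContinuousOn (zE e) {t | sE e t}) (f : K.F) (i : ℕ) :
    ContinuousOn (arcVal zV zE f i) {t | arcVal sV sE f i t} := by
  unfold arcVal
  split_ifs with h0 h1
  · exact h _
  · exact (h _).comp continuous_symm.continuousOn fun t ht => ht
  · exact continuousOn_const

theorem isOpen_arcVal {sV : K.V → Prop} {sE : K.E → I → Prop}
    (h : ∀ e, IsOpen {t | sE e t}) (f : K.F) (i : ℕ) :
    IsOpen {t | arcVal sV sE f i t} := by
  unfold arcVal
  split_ifs with h0 h1
  · exact h _
  · exact (h _).preimage continuous_symm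
  · exact isOpen_const

end CombinatorialComplex

namespace CombinatorialComplex

variable {K : CombinatorialComplex.{u}}

/-! ### Open neighbourhoods of cells -/

/-- An open part of the 1-skeleton is thickened by sweeping its arcs inwards along the radii of each
2-cell. The center is left out, so sectors with different answers do not conflict. -/
theorem exists_isOpen_of_skeleton {sV : K.V → Prop} {sE : K.E → I → Prop}
    (hs : ∀ e, sE e 0 = sV (K.src e)) (ht : ∀ e, sE e 1 = sV (K.tgt e))
    (ho : ∀ e, IsOpen {t | sE e t}) :
    ∃ U : Set K.Space, IsOpen U ∧ (∀ v, pt v ∈ U ↔ sV v) ∧ (∀ e t, edgePt e t ∈ U ↔ sE e t) ∧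
      ∀ f, ∀ i < numArcs f, ∀ ρ t, facePt f i ρ t ∈ U ↔ 0 < ρ ∧ arcVal sV sE f i t := by
  have hc : Compatible sV sE (fun f i ρ t => 0 < ρ ∧ arcVal sV sE f i t) :=
    { src := hs
      tgt := ht
      bdry := fun f i hi t => by simp
      rad := fun f i hi ρ => by rw [arcVal_one_eq_zero hs ht f hi]
      cen := fun f i hi t => by simp }
  obtain ⟨g, hV, hE, hF⟩ := hc.exists_lift
  have hV' : ∀ v, pt v ∈ {y | g y} ↔ sV v := fun v => by rw [Set.mem_ofPred_eq, hV]
  have hE' : ∀ e t, edgePt e t ∈ {y | g y} ↔ sE e t := fun e t => by rw [Set.mem_ofPred_eq, hE]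
  have hF' : ∀ f, ∀ i < numArcs f, ∀ ρ t, facePt f i ρ t ∈ {y | g y} ↔
      0 < ρ ∧ arcVal sV sE f i t := fun f i hi ρ t => by rw [Set.mem_ofPred_eq, hF f i hi]
  refine ⟨{y | g y}, isOpen_space (fun e => ?_) (fun f i hi => ?_), hV', hE', hF'⟩
  · simp only [hE']
    exact ho e
  · simp only [hF' f i hi]
    exact (isOpen_lt continuous_const continuous_fst).inter
      ((isOpen_arcVal ho f i).preimage continuous_snd)

/-- The open star of a vertex, on edges. -/
def starE (v : K.V) (e : K.E) (t : I) : Prop :=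
  ((t : ℝ) < 1 / 2 ∧ K.src e = v) ∨ (1 / 2 < (t : ℝ) ∧ K.tgt e = v)

theorem starE_zero (v : K.V) (e : K.E) : starE v e 0 = (K.src e = v) := by
  simp [starE]

theorem starE_one (v : K.V) (e : K.E) : starE v e 1 = (K.tgt e = v) := by
  simp only [starE, Set.Icc.coe_one, eq_iff_iff]
  norm_num

theorem isOpen_starE (v : K.V) (e : K.E) : IsOpen {t | starE v e t} :=
  ((isOpen_lt continuous_subtype_val continuous_const).inter isOpen_const).union
    ((isOpen_lt continuous_const continuous_subtype_val).inter isOpen_const)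

/-- The interior of an edge. -/
def interiorE (e e' : K.E) (t : I) : Prop := e' = e ∧ 0 < t ∧ t < 1

theorem interiorE_zero (e e' : K.E) : interiorE e e' 0 = False := by simp [interiorE]

theorem interiorE_one (e e' : K.E) : interiorE e e' 1 = False := by simp [interiorE]

theorem isOpen_interiorE (e e' : K.E) : IsOpen {t | interiorE e e' t} :=
  isOpen_const.inter ((isOpen_Ioi (a := (0 : I))).inter (isOpen_Iio (a := (1 : I))))

theorem exists_isOpen_star (v : K.V) :
    ∃ U : Set K.Space, IsOpen U ∧ (∀ u, pt u ∈ U ↔ u = v) ∧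
      (∀ e t, edgePt e t ∈ U ↔ starE v e t) ∧ ∀ f, ∀ i < numArcs f, ∀ ρ t,
      facePt f i ρ t ∈ U ↔ 0 < ρ ∧ arcVal (fun u => u = v) (starE v) f i t :=
  exists_isOpen_of_skeleton (starE_zero v) (starE_one v) (isOpen_starE v)

theorem exists_isOpen_interior (e : K.E) :
    ∃ U : Set K.Space, IsOpen U ∧ (∀ u, pt u ∈ U ↔ False) ∧
      (∀ e' t, edgePt e' t ∈ U ↔ interiorE e e' t) ∧ ∀ f, ∀ i < numArcs f, ∀ ρ t,
      facePt f i ρ t ∈ U ↔ 0 < ρ ∧ arcVal (fun _ => False) (interiorE e) f i t :=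
  exists_isOpen_of_skeleton (interiorE_zero e) (interiorE_one e) (isOpen_interiorE e)

theorem exists_isOpen_disk (f : K.F) :
    ∃ U : Set K.Space, IsOpen U ∧ (∀ u, pt u ∉ U) ∧ (∀ e t, edgePt e t ∉ U) ∧
      ∀ f', ∀ i < numArcs f', ∀ ρ t, facePt f' i ρ t ∈ U ↔ f' = f ∧ ρ < 1 := by
  have hc : Compatible (K := K) (fun _ => False) (fun _ _ => False)
      (fun f' i ρ t => f' = f ∧ ρ < 1) :=
    { src := fun _ => rfl
      tgt := fun _ => rfl
      bdry := fun f i hi t => by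
        unfold arcVal
        simp
      rad := fun f i hi ρ => rfl
      cen := fun f i hi t => rfl }
  obtain ⟨g, hV, hE, hF⟩ := hc.exists_lift
  have hF' : ∀ f', ∀ i < numArcs f', ∀ ρ t, facePt f' i ρ t ∈ {y | g y} ↔
      f' = f ∧ ρ < 1 := fun f i hi ρ t => by rw [Set.mem_ofPred_eq, hF f i hi]
  refine ⟨{y | g y}, isOpen_space (fun e => ?_) (fun f i hi => ?_), fun u => ?_, fun e t => ?_, hF'⟩
  · simp [hE]
  · simp only [hF' f i hi]
    exact isOpen_const.inter ((isOpen_Iio (a := (1 : I))).preimage continuous_fst)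
  · simp [hV]
  · simp [hE]

/-- Every point is a vertex, an interior point of an edge, or an interior point of a 2-cell. -/
theorem Space.cases_interior (y : K.Space) : (∃ v, y = pt v) ∨
    (∃ e, ∃ t : I, 0 < t ∧ t < 1 ∧ y = edgePt e t) ∨
    ∃ f, ∃ i < numArcs f, ∃ ρ t : I, ρ < 1 ∧ y = facePt f i ρ t := by
  have hE : ∀ e t, (∃ v, edgePt e t = pt (K := K) v) ∨
      (∃ e', ∃ t' : I, 0 < t' ∧ t' < 1 ∧ edgePt e t = edgePt e' t') := by
    intro e t
    by_cases h0 : t = 0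
    · exact .inl ⟨_, h0 ▸ edgePt_zero e⟩
    by_cases h1 : t = 1
    · exact .inl ⟨_, h1 ▸ edgePt_one e⟩
    · exact .inr ⟨e, t, unitInterval.pos_iff_ne_zero.2 h0, unitInterval.lt_one_iff_ne_one.2 h1, rfl⟩
  have hS : ∀ e t, (∃ v, edgePt e t = pt (K := K) v) ∨
      (∃ e', ∃ t' : I, 0 < t' ∧ t' < 1 ∧ edgePt e t = edgePt e' t') ∨
      ∃ f, ∃ i < numArcs f, ∃ ρ t' : I, ρ < 1 ∧ edgePt e t = facePt f i ρ t' := fun e t =>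
    (hE e t).imp_right .inl
  rcases y.cases with ⟨v, h⟩ | ⟨e, t, rfl⟩ | ⟨f, i, hi, ρ, t, rfl⟩
  · exact .inl ⟨v, h⟩
  · exact hS e t
  · by_cases h1 : ρ = 1
    · subst h1
      rw [facePt_one f hi]
      unfold arcVal
      split_ifs
      · exact hS _ _
      · exact hS _ _
      · exact .inl ⟨_, rfl⟩
    · exact .inr (.inr ⟨f, i, hi, ρ, t, unitInterval.lt_one_iff_ne_one.2 h1, rfl⟩)

/-! ### Gauges and flat sections -/

section Flat

variable {G : Type v} [Group G] (φ : K.E → G)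

/-- The holonomy of a sequence of edges with orientations. -/
def wordHol (l : List (K.E × ℤˣ)) : G := (l.map fun a => φ a.1 ^ (a.2 : ℤ)).prod

open Classical in
/-- The gauge on edges. -/
noncomputable def gaugeE (e : K.E) (t : I) : G := if t = 1 then (φ e)⁻¹ else 1

/-- The change of gauge from an edge to a 2-cell along an arc of its boundary. -/
def twist (f : K.F) (i : ℕ) : G :=
  if h : i < (K.bdry f).word.length then
    if (K.bdry f).word[i].2 = 1 then (wordHol φ ((K.bdry f).word.take i))⁻¹
    else (wordHol φ ((K.bdry f).word.take (i + 1)))⁻¹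
  else 1

/-- The gauge of a 2-cell on the arcs of its boundary. -/
noncomputable def gaugeArc (f : K.F) (i : ℕ) (t : I) : G :=
  arcVal (fun _ => 1) (gaugeE φ) f i t * twist φ f i

open Classical in
/-- The gauge on 2-cells. -/
noncomputable def gaugeF (f : K.F) (i : ℕ) (ρ t : I) : G :=
  if ρ = 1 then gaugeArc φ f i t else 1

variable {φ}

theorem wordHol_take_succ (l : List (K.E × ℤˣ)) (i : ℕ) (hi : i < l.length) :
    wordHol φ (l.take (i + 1)) = wordHol φ (l.take i) * φ l[i].1 ^ (l[i].2 : ℤ) := by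
  simp only [wordHol]
  rw [List.take_succ_eq_append_getElem hi, List.map_append, List.prod_append]
  simp

theorem word_eq_nil_of_le {f : K.F} {i : ℕ} (hi : i < numArcs f)
    (h : ¬ i < (K.bdry f).word.length) : (K.bdry f).word = [] := by
  apply List.eq_nil_of_length_eq_zero
  by_contra h0
  rw [numArcs_eq (Nat.pos_of_ne_zero h0)] at hi
  exact h hi

theorem gaugeArc_zero (f : K.F) {i : ℕ} (hi : i < numArcs f) :
    gaugeArc φ f i 0 = (wordHol φ ((K.bdry f).word.take i))⁻¹ := by
  unfold gaugeArc arcVal twist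
  split_ifs with h h1
  · simp [gaugeE]
  · have h2 := (Int.units_eq_one_or (K.bdry f).word[i].2).resolve_left h1
    rw [wordHol_take_succ _ _ h, h2]
    simp [gaugeE]
  · simp [word_eq_nil_of_le hi h, wordHol]

theorem gaugeArc_one (f : K.F) {i : ℕ} (hi : i < numArcs f) :
    gaugeArc φ f i 1 = (wordHol φ ((K.bdry f).word.take (i + 1)))⁻¹ := by
  unfold gaugeArc arcVal twist
  split_ifs with h h1
  · rw [wordHol_take_succ _ _ h, h1]
    simp [gaugeE]
  · simp [gaugeE]
  · simp [word_eq_nil_of_le hi h, wordHol]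

/-- After a full turn the accumulated holonomy must return to 1. All later uses of the triviality of
boundary holonomy in building the bundle come down to this. -/
theorem gaugeArc_one_eq_zero (hφ : ∀ f, wordHol φ (K.bdry f).word = 1) (f : K.F) {i : ℕ}
    (hi : i < numArcs f) : gaugeArc φ f i 1 = gaugeArc φ f ((i + 1) % numArcs f) 0 := by
  rw [gaugeArc_one f hi, gaugeArc_zero f (Nat.mod_lt _ (numArcs_pos f))]
  rcases Nat.lt_or_ge (i + 1) (numArcs f) with h | h
  · rw [Nat.mod_eq_of_lt h]
  · have h1 : i + 1 = numArcs f := le_antisymm hi h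
    rw [h1, Nat.mod_self, List.take_of_length_le (show _ ≤ numArcs f from le_max_right _ _), hφ]
    simp [wordHol]

variable (φ) in
/-- A section over an open set which is locally constant with respect to the gauges of the
cells. -/
structure IsFlat [TopologicalSpace G] (U : Set K.Space) (s : K.Space → G) : Prop where
  isOpen : IsOpen U
  onE : ∀ e, ContinuousOn (fun t => s (edgePt e t) * gaugeE φ e t) {t | edgePt e t ∈ U}
  onF : ∀ f, ∀ i < numArcs f, ContinuousOn
    (fun p : I × I => s (facePt f i p.1 p.2) * gaugeF φ f i p.1 p.2)
      {p : I × I | facePt f i p.1 p.2 ∈ U}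

theorem arcVal_mul (zV zV' : K.V → G) (zE zE' : K.E → I → G) (f : K.F) (i : ℕ) (t : I) :
    arcVal zV zE f i t * arcVal zV' zE' f i t =
      arcVal (fun v => zV v * zV' v) (fun e t => zE e t * zE' e t) f i t := by
  unfold arcVal
  split_ifs <;> rfl

variable [TopologicalSpace G] [DiscreteTopology G]

theorem IsFlat.const_mul {U : Set K.Space} {s : K.Space → G} (h : IsFlat φ U s) (g : G) :
    IsFlat φ U (fun y => g * s y) where
  isOpen := h.isOpen
  onE e := by
    simp only [mul_assoc]
    exact (continuous_of_discreteTopology (f := fun x => g * x)).comp_continuousOn (h.onE e)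
  onF f i hi := by
    simp only [mul_assoc]
    exact (continuous_of_discreteTopology (f := fun x => g * x)).comp_continuousOn (h.onF f i hi)

-- A section given on vertices and edges extends along the radii of the 2-cells. Inside a cell the
-- gauge is 1, so the section takes the factor `gaugeArc` there; on the boundary the gauge itself
-- supplies that factor. The product of section and gauge thus does not depend on the radius. The
-- value at the center is a dummy, since the center lies outside the open set.
open Classical in
theorem exists_isFlat_of_skeleton (hφ : ∀ f, wordHol φ (K.bdry f).word = 1) {U : Set K.Space}
    (hU : IsOpen U) {sV : K.V → Prop} {sE : K.E → I → Prop}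
    (hUE : ∀ e t, edgePt e t ∈ U ↔ sE e t)
    (hUF : ∀ f, ∀ i < numArcs f, ∀ ρ t, facePt f i ρ t ∈ U ↔ 0 < ρ ∧ arcVal sV sE f i t)
    {qV : K.V → G} {qE : K.E → I → G} (hs : ∀ e, qE e 0 = qV (K.src e))
    (ht : ∀ e, qE e 1 = qV (K.tgt e))
    (hq : ∀ e, ContinuousOn (fun t => qE e t * gaugeE φ e t) {t | sE e t}) :
    ∃ s, IsFlat φ U s := by
  have hc : Compatible qV qE (fun f i ρ t => if ρ = 0 then 1 else
      arcVal qV qE f i t * if ρ = 1 then 1 else gaugeArc φ f i t) :=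
    { src := hs
      tgt := ht
      bdry := fun f i hi t => by simp
      rad := fun f i hi ρ => by
        rw [arcVal_one_eq_zero hs ht f hi, gaugeArc_one_eq_zero hφ f hi]
      cen := fun f i hi t => by simp }
  obtain ⟨g, hV, hE, hF⟩ := hc.exists_lift
  refine ⟨g, hU, fun e => ?_, fun f i hi => ?_⟩
  · simp only [hE, hUE]
    exact hq e
  · simp only [hF f i hi, hUF f i hi]
    have h1 : ContinuousOn (fun p : I × I => arcVal (fun v => qV v * 1)
        (fun e t => qE e t * gaugeE φ e t) f i p.2 * twist φ f i)
        {p : I × I | 0 < p.1 ∧ arcVal sV sE f i p.2} := by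
      refine (continuous_of_discreteTopology (f := fun x => x * twist φ f i)).comp_continuousOn ?_
      exact (continuousOn_arcVal hq f i).comp continuous_snd.continuousOn fun p hp => hp.2
    refine h1.congr ?_
    rintro ⟨ρ, t⟩ ⟨hρ, -⟩
    have hρ' : ρ ≠ 0 := (unitInterval.pos_iff_ne_zero.1 hρ)
    simp only [if_neg hρ', gaugeF]
    rw [← arcVal_mul, mul_assoc]
    split_ifs
    · simp [gaugeArc, mul_assoc]
    · simp [gaugeArc, mul_assoc]

open Classical in
theorem exists_isFlat (hφ : ∀ f, wordHol φ (K.bdry f).word = 1) (y : K.Space) :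
    ∃ U s, IsFlat φ U s ∧ y ∈ U ∧ s y = 1 := by
  suffices h : ∃ U s, IsFlat φ U s ∧ y ∈ U by
    obtain ⟨U, s, h1, h2⟩ := h
    exact ⟨U, _, h1.const_mul (s y)⁻¹, h2, inv_mul_cancel _⟩
  rcases y.cases_interior with ⟨v, rfl⟩ | ⟨e, t, h0, h1, rfl⟩ | ⟨f, i, hi, ρ, t, hρ, rfl⟩
  · obtain ⟨U, hU, hV, hE, hF⟩ := exists_isOpen_star v
    -- The gauge of an edge jumps only at its end point. Near the source the section is 1; near the
    -- target it is `(φ e)⁻¹` except at the end itself, where the gauge supplies this value. The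
    -- midpoint is outside the star, so the change there is harmless.
    obtain ⟨s, hs⟩ := exists_isFlat_of_skeleton hφ hU hE hF (qV := fun _ => 1)
      (qE := fun e t => if (t : ℝ) < 1 / 2 ∨ t = 1 then 1 else (φ e)⁻¹)
      (by simp) (by simp) (by
        intro e t ht
        apply ContinuousAt.continuousWithinAt
        rcases ht with ⟨ht, -⟩ | ⟨ht, -⟩
        · refine continuousAt_const.congr (f := fun _ => 1) ?_
          filter_upwards [(isOpen_lt continuous_subtype_val continuous_const).mem_nhds ht] with r hr
          have hr1 : r ≠ 1 := by
            rintro rfl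
            rw [Set.Icc.coe_one] at hr
            norm_num at hr
          simp only [gaugeE, if_neg hr1, if_pos (Or.inl hr), mul_one]
        · refine continuousAt_const.congr (f := fun _ => (φ e)⁻¹) ?_
          filter_upwards [(isOpen_lt continuous_const continuous_subtype_val).mem_nhds ht] with r hr
          simp only [gaugeE, not_lt.2 hr.le, false_or]
          split_ifs <;> simp)
    exact ⟨U, s, hs, (hV v).2 rfl⟩
  · obtain ⟨U, hU, hV, hE, hF⟩ := exists_isOpen_interior e
    obtain ⟨s, hs⟩ := exists_isFlat_of_skeleton hφ hU hE hF (qV := fun _ => 1)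
      (qE := fun e t => 1) (by simp) (by simp) (by
        intro e
        refine (continuousOn_const (c := (1 : G))).congr ?_
        rintro t ⟨-, -, ht⟩
        simp [gaugeE, ht.ne])
    exact ⟨U, s, hs, (hE e t).2 ⟨rfl, h0, h1⟩⟩
  · obtain ⟨U, hU, hV, hE, hF⟩ := exists_isOpen_disk f
    refine ⟨U, fun _ => 1, ⟨hU, fun e => ?_, fun f' j hj => ?_⟩, (hF f i hi ρ t).2 ⟨rfl, hρ⟩⟩
    · simp [hE]
    · refine (continuousOn_const (c := (1 : G))).congr ?_
      rintro ⟨ρ, t⟩ hp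
      have := ((hF f' j hj ρ t).1 hp).2
      simp [gaugeF, this.ne]

/-- The gauge is a right factor of both sections and cancels in the quotient. Hence transition
functions are locally constant in every cell, although the sections are not. -/
theorem IsFlat.continuousOn_mul_inv {U U' : Set K.Space} {s s' : K.Space → G} (h : IsFlat φ U s)
    (h' : IsFlat φ U' s') : ContinuousOn (fun y => s' y * (s y)⁻¹) (U ∩ U') := by
  have key : ∀ {Y : Type} [TopologicalSpace Y] {A B : Set Y} {a b : Y → G} {c : Y → G},
      ContinuousOn (fun y => a y * c y) A → ContinuousOn (fun y => b y * c y) B →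
      ContinuousOn (fun y => b y * (a y)⁻¹) (A ∩ B) := by
    intro Y _ A B a b c ha hb
    refine ((continuous_of_discreteTopology (f := fun x : G × G => x.2 * x.1⁻¹)).comp_continuousOn
      ((ha.mono Set.inter_subset_left).prodMk (hb.mono Set.inter_subset_right))).congr ?_
    intro y _
    simp
  exact continuousOn_space (h.isOpen.inter h'.isOpen) (fun e => key (h.onE e) (h'.onE e))
    (fun f i hi => key (h.onF f i hi) (h'.onF f i hi))

end Flat

end CombinatorialComplex

namespace CombinatorialComplex

variable {K : CombinatorialComplex.{u}}

/-! ### The covering space of a flat bundle and its holonomy -/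

section Holonomy

variable {G : Type v} [Group G] [TopologicalSpace G] [DiscreteTopology G] {φ : K.E → G}

/-- The principal bundle with discrete fiber `G` defined by the flat sections. -/
noncomputable def flatBundle (hφ : ∀ f, wordHol φ (K.bdry f).word = 1) :
    FiberBundleCore {p : Set K.Space × (K.Space → G) // IsFlat φ p.1 p.2} K.Space G where
  baseSet i := i.1.1
  isOpen_baseSet i := i.2.isOpen
  indexAt y := ⟨((exists_isFlat hφ y).choose, (exists_isFlat hφ y).choose_spec.choose),
    (exists_isFlat hφ y).choose_spec.choose_spec.1⟩
  mem_baseSet_at y := (exists_isFlat hφ y).choose_spec.choose_spec.2.1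
  -- Transition functions act on the left, which leaves right multiplication free to act on the
  -- whole bundle.
  coordChange i j y g := j.1.2 y * (i.1.2 y)⁻¹ * g
  coordChange_self i y _ g := by simp
  continuousOn_coordChange i j := by
    refine ContinuousOn.mul ?_ continuousOn_snd
    exact (i.2.continuousOn_mul_inv j.2).comp continuousOn_fst fun p hp => hp.1
  coordChange_comp i j k y _ g := by simp [mul_assoc]

theorem flatBundle_indexAt (hφ : ∀ f, wordHol φ (K.bdry f).word = 1) (y : K.Space) :
    ((flatBundle hφ).indexAt y).1.2 y = 1 :=
  (exists_isFlat hφ y).choose_spec.choose_spec.2.2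

/-- The preferred section at each point is normalized to 1 there, so `(y, g)` has coordinate `s y *
g` in the chart of a flat section `s`. -/
theorem continuous_flatBundle_mk (hφ : ∀ f, wordHol φ (K.bdry f).word = 1) {Y : Type*}
    [TopologicalSpace Y] {γ : Y → K.Space} {h : Y → G} (hγ : Continuous γ)
    (hh : ∀ U s, IsFlat φ U s → ContinuousOn (fun t => s (γ t) * h t) {t | γ t ∈ U}) :
    Continuous fun t => (⟨γ t, h t⟩ : (flatBundle hφ).TotalSpace) := by
  rw [continuous_iff_continuousAt]
  intro t
  rw [FiberBundle.continuousAt_totalSpace]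
  refine ⟨hγ.continuousAt, ?_⟩
  set i := (flatBundle hφ).indexAt (γ t) with hi
  have hmem : γ t ∈ i.1.1 := (flatBundle hφ).mem_baseSet_at (γ t)
  have h1 : ContinuousAt (fun r => i.1.2 (γ r) * h r) t :=
    (hh _ _ i.2).continuousAt ((i.2.isOpen.preimage hγ).mem_nhds hmem)
  refine h1.congr (Filter.Eventually.of_forall fun r => ?_)
  change _ = i.1.2 (γ r) * (((flatBundle hφ).indexAt (γ r)).1.2 (γ r))⁻¹ * h r
  rw [flatBundle_indexAt, inv_one, mul_one]

theorem isCoveringMap_flatBundle (hφ : ∀ f, wordHol φ (K.bdry f).word = 1) :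
    IsCoveringMap (flatBundle hφ).proj :=
  FiberBundle.isCoveringMap (F := G) (E := (flatBundle hφ).Fiber)

/-- The coordinate of a point of the bundle in its fiber. -/
def bundleCoord {hφ : ∀ f, wordHol φ (K.bdry f).word = 1} (q : (flatBundle hφ).TotalSpace) : G :=
  q.2

/-- Parallel transport of an element of the fiber along a homotopy class of paths. -/
noncomputable def transport (hφ : ∀ f, wordHol φ (K.bdry f).word = 1) {y z : K.Space}
    (γ : Path.Homotopic.Quotient y z) (g : G) : G :=
  bundleCoord ((isCoveringMap_flatBundle hφ).monodromy γ ⟨⟨y, g⟩, rfl⟩).1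

theorem monodromy_flatBundle (hφ : ∀ f, wordHol φ (K.bdry f).word = 1) {y z : K.Space}
    (γ : Path.Homotopic.Quotient y z) (g : G) :
    (isCoveringMap_flatBundle hφ).monodromy γ ⟨⟨y, g⟩, rfl⟩ = ⟨⟨z, (transport hφ γ g : G)⟩, rfl⟩ := by
  have key : ∀ q : (flatBundle hφ).proj ⁻¹' {z},
      q = ⟨⟨z, (bundleCoord q.1 : G)⟩, rfl⟩ := by
    rintro ⟨⟨z', g'⟩, h⟩
    obtain rfl : z' = z := h
    rfl
  exact key _

theorem transport_trans (hφ : ∀ f, wordHol φ (K.bdry f).word = 1) {x y z : K.Space}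
    (γ : Path.Homotopic.Quotient x y) (γ' : Path.Homotopic.Quotient y z) (g : G) :
    transport hφ (γ.trans γ') g = transport hφ γ' (transport hφ γ g) := by
  have h := (isCoveringMap_flatBundle hφ).monodromy_trans_apply γ γ' ⟨⟨x, g⟩, rfl⟩
  rw [monodromy_flatBundle, monodromy_flatBundle, monodromy_flatBundle] at h
  have h' := congrArg (fun q : (flatBundle hφ).proj ⁻¹' {z} => bundleCoord q.1) h
  exact h'

/-- Uniqueness of path lifting: any continuous lift computes the transport. -/
theorem transport_of_lift (hφ : ∀ f, wordHol φ (K.bdry f).word = 1) {y z : K.Space}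
    (γ : Path y z) (h : I → G)
    (hc : Continuous fun t => (⟨γ t, h t⟩ : (flatBundle hφ).TotalSpace)) :
    transport hφ (.mk γ) (h 0) = h 1 := by
  have hz : γ 0 = (flatBundle hφ).proj ⟨y, h 0⟩ := γ.source
  have h1 := ((isCoveringMap_flatBundle hφ).eq_liftPath_iff (γ := γ.toContinuousMap)
    (e := ⟨y, h 0⟩) hz (Γ := fun t => ⟨γ t, h t⟩)).2
    ⟨hc, rfl, by
      change (⟨γ 0, h 0⟩ : (flatBundle hφ).TotalSpace) = ⟨y, h 0⟩
      rw [γ.source]⟩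
  have h2 := congrFun h1 1
  exact (congrArg (fun q : (flatBundle hφ).TotalSpace => bundleCoord q) h2).symm

/-- Right multiplication by `b` commutes with the left transition functions, so it takes a lift of a
path to another lift. Transport is therefore determined by its value at 1. -/
theorem transport_mul (hφ : ∀ f, wordHol φ (K.bdry f).word = 1) {y z : K.Space}
    (γ : Path.Homotopic.Quotient y z) (g b : G) :
    transport hφ γ (g * b) = transport hφ γ g * b := by
  induction γ using Path.Homotopic.Quotient.ind with
  | _ γ =>
  have hz : γ 0 = (flatBundle hφ).proj ⟨y, g⟩ := γ.source
  let Γ := (isCoveringMap_flatBundle hφ).liftPath γ.toContinuousMap ⟨y, g⟩ hz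
  have hΓ : ∀ t, (Γ t).1 = γ t :=
    fun t => congrFun ((isCoveringMap_flatBundle hφ).liftPath_lifts γ.toContinuousMap _ hz) t
  have hΓ0 : Γ 0 = ⟨y, g⟩ := (isCoveringMap_flatBundle hφ).liftPath_zero _ _ hz
  have hΓ' : ∀ t, Γ t = ⟨γ t, (bundleCoord (Γ t) : G)⟩ := by
    intro t
    rw [← hΓ t]
    rfl
  have hΓc : Continuous fun t => (⟨γ t, (bundleCoord (Γ t) : G)⟩ : (flatBundle hφ).TotalSpace) := by
    have := Γ.continuous
    rwa [show (Γ : I → (flatBundle hφ).TotalSpace) = _ from funext hΓ'] at this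
  have hR : Continuous fun t => (⟨γ t, bundleCoord (Γ t) * b⟩ : (flatBundle hφ).TotalSpace) := by
    refine continuous_flatBundle_mk hφ γ.continuous fun U s hs => ?_
    let i : {p : Set K.Space × (K.Space → G) // IsFlat φ p.1 p.2} := ⟨(U, s), hs⟩
    have h1 : ContinuousOn (fun t => ((flatBundle hφ).localTriv i (Γ t)).2) {t | γ t ∈ U} := by
      refine continuousOn_snd.comp (t := Set.univ) (((flatBundle hφ).localTriv i).continuousOn.comp
        Γ.continuous.continuousOn ?_) (Set.mapsTo_univ _ _)
      intro t ht
      rw [(flatBundle hφ).mem_localTriv_source]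
      rw [hΓ]
      exact ht
    have h2 : ∀ t, ((flatBundle hφ).localTriv i (Γ t)).2 = s (γ t) * bundleCoord (Γ t) := by
      intro t
      change s (Γ t).1 * (((flatBundle hφ).indexAt (Γ t).1).1.2 (Γ t).1)⁻¹ * bundleCoord (Γ t) = _
      rw [flatBundle_indexAt, inv_one, mul_one, hΓ]
    simp only [h2] at h1
    refine ((continuous_of_discreteTopology (f := fun x => x * b)).comp_continuousOn h1).congr ?_
    intro t _
    simp [mul_assoc]
  have e1 := transport_of_lift hφ γ (fun t => bundleCoord (Γ t)) hΓc
  have e2 := transport_of_lift hφ γ (fun t => bundleCoord (Γ t) * b) hR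
  have e3 : bundleCoord (Γ 0) = g := by rw [hΓ0]; rfl
  simp only [e3] at e1 e2
  rw [e1]
  exact e2

theorem transport_refl (hφ : ∀ f, wordHol φ (K.bdry f).word = 1) (y : K.Space) (g : G) :
    transport hφ (.refl y) g = g := by
  have h := congrFun ((isCoveringMap_flatBundle hφ).monodromy_refl (x := y)) ⟨⟨y, g⟩, rfl⟩
  exact congrArg (fun q : (flatBundle hφ).proj ⁻¹' {y} => bundleCoord q.1) h

theorem transport_edgePath (hφ : ∀ f, wordHol φ (K.bdry f).word = 1) (e : K.E) (g : G) :
    transport hφ (.mk (edgePath e)) g = (φ e)⁻¹ * g := by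
  -- The gauge is itself a lift of the edge: flatness of `s` says exactly that `s` times the gauge
  -- is locally constant.
  have h := transport_of_lift hφ (edgePath e) (fun t => gaugeE φ e t * g) (by
    refine continuous_flatBundle_mk hφ (edgePath e).continuous fun U s hs => ?_
    simp only [← mul_assoc]
    exact (continuous_of_discreteTopology (f := fun x => x * g)).comp_continuousOn (hs.onE e))
  simpa [gaugeE] using h

theorem transport_edgePath_symm (hφ : ∀ f, wordHol φ (K.bdry f).word = 1) (e : K.E) (g : G) :
    transport hφ (.mk (edgePath e).symm) g = φ e * g := by
  have h := transport_trans hφ (.mk (edgePath e)) (.mk (edgePath e).symm) (φ e * g)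
  rw [transport_edgePath, ← Path.Homotopic.Quotient.mk_trans,
    Path.Homotopic.Quotient.eq.2 ⟨(Path.Homotopy.reflTransSymm (edgePath e)).symm⟩,
    Path.Homotopic.Quotient.mk_refl, transport_refl] at h
  simpa using h.symm

theorem transport_realizePath (hφ : ∀ f, wordHol φ (K.bdry f).word = 1) {x w : K.V}
    (p : K.EdgePath x w) (g : G) :
    transport hφ (.mk (realizePath p)) g = (wordHol φ p.word)⁻¹ * g := by
  induction p generalizing g with
  | nil x =>
    simp only [realizePath, Path.Homotopic.Quotient.mk_refl, transport_refl]
    simp [wordHol, OrientedGraph.EdgePath.word]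
  | fwd e p ih =>
    simp only [realizePath, Path.Homotopic.Quotient.mk_trans]
    rw [transport_trans, transport_edgePath, ih]
    simp [wordHol, OrientedGraph.EdgePath.word, mul_assoc]
  | bwd e p ih =>
    simp only [realizePath, Path.Homotopic.Quotient.mk_trans]
    rw [transport_trans, transport_edgePath_symm, ih]
    simp [wordHol, OrientedGraph.EdgePath.word, mul_assoc]

end Holonomy

/-- Elements assigned to the edges such that the boundary of every 2-cell has trivial holonomy
define a homomorphism on the fundamental group. -/
theorem exists_holonomy {G : Type v} [Group G] {φ : K.E → G}
    (hφ : ∀ f, wordHol φ (K.bdry f).word = 1) (x : K.V) :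
    ∃ μ : PiOne K.Space (pt x) →* G,
      ∀ p : K.EdgePath x x, μ (PiOne.mk (realizePath p)) = wordHol φ p.word := by
  let _ : TopologicalSpace G := ⊥
  have : DiscreteTopology G := ⟨rfl⟩
  -- Transport along a concatenation multiplies in the reverse order; the inverse restores the order
  -- of concatenation.
  refine ⟨MonoidHom.mk' (fun γ => (transport hφ γ.unop.toPath 1)⁻¹) ?_, fun p => ?_⟩
  · intro a b
    change (transport hφ (Path.Homotopic.Quotient.trans a.unop.toPath b.unop.toPath) 1)⁻¹ = _
    rw [transport_trans, ← mul_inv_rev, ← transport_mul, one_mul]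
  · change (transport hφ (.mk (realizePath p)) 1)⁻¹ = _
    rw [transport_realizePath]
    simp

end CombinatorialComplex

/-! ### Concatenation and reversal of edge paths -/

namespace OrientedGraph.EdgePath

variable {G : OrientedGraph.{u}}

/-- Concatenation of edge paths. -/
def append : {x y z : G.V} → G.EdgePath x y → G.EdgePath y z → G.EdgePath x z
  | _, _, _, .nil _, q => q
  | _, _, _, .fwd e p, q => .fwd e (p.append q)
  | _, _, _, .bwd e p, q => .bwd e (p.append q)

/-- The inverse edge path. -/
def reverse : {x y : G.V} → G.EdgePath x y → G.EdgePath y x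
  | _, _, .nil x => .nil x
  | _, _, .fwd e p => p.reverse.append (.bwd e (.nil _))
  | _, _, .bwd e p => p.reverse.append (.fwd e (.nil _))

theorem word_append {x y z : G.V} (p : G.EdgePath x y) (q : G.EdgePath y z) :
    (p.append q).word = p.word ++ q.word := by
  induction p with
  | nil x => rfl
  | fwd e p ih => simp [append, word, ih]
  | bwd e p ih => simp [append, word, ih]

end OrientedGraph.EdgePath

/-! ### Homotopy classes of edge paths -/

namespace CombinatorialComplex

variable {K : CombinatorialComplex.{u}}

/-- The homotopy class of an edge path. -/
noncomputable def edgeClass {x w : K.V} (p : K.EdgePath x w) :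
    Path.Homotopic.Quotient (pt x) (pt w) := .mk (realizePath p)

theorem edgeClass_nil (x : K.V) :
    edgeClass (.nil x : K.EdgePath x x) = .refl (pt x) := by
  rw [edgeClass, realizePath, Path.Homotopic.Quotient.mk_refl]

theorem edgeClass_fwd (e : K.E) {w : K.V} (p : K.EdgePath (K.tgt e) w) :
    edgeClass (.fwd e p : K.EdgePath _ _) =
      (Path.Homotopic.Quotient.mk (edgePath e)).trans (edgeClass p) := by
  rw [edgeClass, realizePath, Path.Homotopic.Quotient.mk_trans, edgeClass]

theorem edgeClass_bwd (e : K.E) {w : K.V} (p : K.EdgePath (K.src e) w) :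
    edgeClass (.bwd e p : K.EdgePath _ _) =
      (Path.Homotopic.Quotient.mk (edgePath e)).symm.trans (edgeClass p) := by
  rw [edgeClass, realizePath, Path.Homotopic.Quotient.mk_trans, edgeClass,
    Path.Homotopic.Quotient.mk_symm]

theorem edgeClass_append {x y z : K.V} (p : K.EdgePath x y) (q : K.EdgePath y z) :
    edgeClass (p.append q) = (edgeClass p).trans (edgeClass q) := by
  induction p with
  | nil x =>
    rw [edgeClass_nil, Path.Homotopic.Quotient.refl_trans]
    rfl
  | fwd e p ih =>
    rw [OrientedGraph.EdgePath.append, edgeClass_fwd, edgeClass_fwd, ih,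
      Path.Homotopic.Quotient.trans_assoc]
  | bwd e p ih =>
    rw [OrientedGraph.EdgePath.append, edgeClass_bwd, edgeClass_bwd, ih,
      Path.Homotopic.Quotient.trans_assoc]

theorem eq_symm_of_trans_eq_refl {X : Type*} [TopologicalSpace X] {y z : X}
    {β : Path.Homotopic.Quotient y z} {γ : Path.Homotopic.Quotient z y}
    (h : β.trans γ = .refl y) : γ = β.symm := by
  rw [← Path.Homotopic.Quotient.refl_trans γ, ← Path.Homotopic.Quotient.symm_trans β,
    Path.Homotopic.Quotient.trans_assoc, h, Path.Homotopic.Quotient.trans_refl]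

theorem trans_trans_symm {X : Type*} [TopologicalSpace X] {x y z : X}
    (β : Path.Homotopic.Quotient x y) (γ : Path.Homotopic.Quotient y z) :
    (β.trans γ).trans γ.symm = β := by
  rw [Path.Homotopic.Quotient.trans_assoc, Path.Homotopic.Quotient.trans_symm,
    Path.Homotopic.Quotient.trans_refl]

theorem trans_symm_trans {X : Type*} [TopologicalSpace X] {x y z : X}
    (β : Path.Homotopic.Quotient x y) (γ : Path.Homotopic.Quotient z y) :
    (β.trans γ.symm).trans γ = β := by
  rw [Path.Homotopic.Quotient.trans_assoc, Path.Homotopic.Quotient.symm_trans,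
    Path.Homotopic.Quotient.trans_refl]

theorem edgeClass_reverse {x y : K.V} (p : K.EdgePath x y) :
    edgeClass p.reverse = (edgeClass p).symm := by
  apply eq_symm_of_trans_eq_refl
  induction p with
  | nil x =>
    rw [OrientedGraph.EdgePath.reverse, edgeClass_nil, Path.Homotopic.Quotient.refl_trans]
  | fwd e p ih =>
    rw [OrientedGraph.EdgePath.reverse, edgeClass_append, edgeClass_fwd, edgeClass_bwd,
      edgeClass_nil, Path.Homotopic.Quotient.trans_refl, Path.Homotopic.Quotient.trans_assoc,
      ← Path.Homotopic.Quotient.trans_assoc (edgeClass p), ih, Path.Homotopic.Quotient.refl_trans,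
      Path.Homotopic.Quotient.trans_symm]
  | bwd e p ih =>
    rw [OrientedGraph.EdgePath.reverse, edgeClass_append, edgeClass_bwd, edgeClass_fwd,
      edgeClass_nil, Path.Homotopic.Quotient.trans_refl, Path.Homotopic.Quotient.trans_assoc,
      ← Path.Homotopic.Quotient.trans_assoc (edgeClass p), ih, Path.Homotopic.Quotient.refl_trans,
      Path.Homotopic.Quotient.symm_trans]

instance : ContractibleSpace I :=
  (convex_Icc (0 : ℝ) 1).contractibleSpace ⟨0, by simp⟩

/-- Paths which factor through a simply connected space are homotopic. -/
theorem mk_eq_of_factor {X Y : Type*} [TopologicalSpace X] [TopologicalSpace Y]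
    [SimplyConnectedSpace Y] {c : Y → X} (hc : Continuous c) {a b : Y} (α α' : Path a b) {y z : X}
    (κ κ' : Path y z) (h : ∀ s, κ s = c (α s)) (h' : ∀ s, κ' s = c (α' s)) :
    Path.Homotopic.Quotient.mk κ = .mk κ' := by
  obtain rfl : c a = y := by rw [← κ.source, h, α.source]
  obtain rfl : c b = z := by rw [← κ.target, h, α.target]
  have e : κ = α.map hc := Path.ext (funext h)
  have e' : κ' = α'.map hc := Path.ext (funext h')
  rw [e, e', Path.Homotopic.Quotient.eq]
  exact (SimplyConnectedSpace.paths_homotopic α α').map ⟨c, hc⟩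

theorem sigma_trans_const {X : Type*} [TopologicalSpace X] {x y z : X}
    (β : Path.Homotopic.Quotient x y) (κ : Path y z) (h : ∀ s, κ s = y) :
    (⟨z, β.trans (.mk κ)⟩ : Σ z, Path.Homotopic.Quotient x z) = ⟨y, β⟩ := by
  obtain rfl : z = y := by rw [← κ.target, h]
  have e : κ = Path.refl z := Path.ext (funext h)
  rw [e, Path.Homotopic.Quotient.mk_refl, Path.Homotopic.Quotient.trans_refl]

/-! ### Classes of paths which run along edges and end in a given cell -/

/-- The classes of paths from `x` to `c y` which run along edges to the vertex `u = c b`, and then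
inside the cell `c`. -/
def reach (x : K.V) {Y : Type} [TopologicalSpace Y] (c : Y → K.Space) (b : Y) (u : K.V) (y : Y) :
    Set (Σ z : K.Space, Path.Homotopic.Quotient (pt x) z) :=
  {z | ∃ (p : K.EdgePath x u) (α : Path b y) (κ : Path (pt u) (c y)),
    (∀ s, κ s = c (α s)) ∧ z = ⟨c y, (edgeClass p).trans (.mk κ)⟩}

section Reach

variable {x : K.V} {Y Y' : Type} [TopologicalSpace Y] [TopologicalSpace Y']
  {c : Y → K.Space} {b b' y y' : Y} {u u' : K.V}

theorem trans_mem_reach {β : Path.Homotopic.Quotient (pt x) (c y)}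
    (hβ : ⟨c y, β⟩ ∈ reach x c b u y) (δ : Path y y') (κ : Path (c y) (c y'))
    (hκ : ∀ s, κ s = c (δ s)) : ⟨c y', β.trans (.mk κ)⟩ ∈ reach x c b u y' := by
  obtain ⟨p, α, κ', hκ', h⟩ := hβ
  obtain rfl : β = (edgeClass p).trans (.mk κ') := by simpa using h
  refine ⟨p, α.trans δ, κ'.trans κ, fun s => ?_, ?_⟩
  · rw [Path.trans_apply, Path.trans_apply]
    split_ifs
    · exact hκ' _
    · exact hκ _
  · rw [Path.Homotopic.Quotient.trans_assoc, Path.Homotopic.Quotient.mk_trans]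

theorem trans_mem_reach_iff (β : Path.Homotopic.Quotient (pt x) (c y))
    (δ : Path y y') (κ : Path (c y) (c y')) (hκ : ∀ s, κ s = c (δ s)) :
    ⟨c y', β.trans (.mk κ)⟩ ∈ reach x c b u y' ↔ ⟨c y, β⟩ ∈ reach x c b u y := by
  refine ⟨fun h => ?_, fun h => trans_mem_reach h δ κ hκ⟩
  have h1 := trans_mem_reach h δ.symm κ.symm fun s => hκ (σ s)
  rwa [Path.Homotopic.Quotient.mk_symm, trans_trans_symm] at h1

/-- Used at the center of a 2-cell, where a whole side of the polar square is collapsed to one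
point. -/
theorem reach_eq_of_const (δ : Path y y') (hδ : ∀ s, c (δ s) = c y) :
    reach x c b u y = reach x c b u y' := by
  have key : ∀ {y y' : Y} (δ : Path y y') (hδ : ∀ s, c (δ s) = c y),
      reach x c b u y ⊆ reach x c b u y' := by
    intro y y' δ hδ z hz
    have hz' := hz
    obtain ⟨p, α, κ, hκ, rfl⟩ := hz'
    have hy : c y = c y' := by rw [← hδ 1, δ.target]
    let κ' : Path (c y) (c y') := (Path.refl (c y)).cast rfl hy.symm
    have h1 := trans_mem_reach hz δ κ' (fun s => (hδ s).symm)
    rwa [sigma_trans_const _ κ' (fun s => rfl)] at h1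
  refine Set.Subset.antisymm (key δ hδ) (key δ.symm fun s => ?_)
  change c (δ (σ s)) = _
  rw [hδ, ← hδ 1, δ.target]

/-- The base vertex of a cell may be moved along a path in the cell that is homotopic to an edge
path: append that edge path and run back inside the cell. -/
theorem reach_change_base (q : K.EdgePath u u') (ε : Path b b') (κε : Path (pt u) (pt u'))
    (hε : ∀ s, κε s = c (ε s)) (hq : Path.Homotopic.Quotient.mk κε = edgeClass q) :
    reach x c b u y = reach x c b' u' y := by
  have key : ∀ {b b' : Y} {u u' : K.V} (q : K.EdgePath u u') (ε : Path b b')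
      (κε : Path (pt u) (pt u')) (hε : ∀ s, κε s = c (ε s))
      (hq : Path.Homotopic.Quotient.mk κε = edgeClass q),
      reach x c b u y ⊆ reach x c b' u' y := by
    rintro b b' u u' q ε κε hε hq _ ⟨p, α, κ, hκ, rfl⟩
    refine ⟨p.append q, ε.symm.trans α, κε.symm.trans κ, fun s => ?_, ?_⟩
    · rw [Path.trans_apply, Path.trans_apply]
      split_ifs
      · exact hε _
      · exact hκ _
    · rw [edgeClass_append, Path.Homotopic.Quotient.mk_trans,
        ← Path.Homotopic.Quotient.trans_assoc, Path.Homotopic.Quotient.mk_symm, hq,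
        trans_trans_symm]
  refine Set.Subset.antisymm (key q ε κε hε hq) (key q.reverse ε.symm κε.symm
    (fun s => hε (σ s)) ?_)
  rw [Path.Homotopic.Quotient.mk_symm, hq, edgeClass_reverse]

/-- Passing to a smaller path-connected parameter space changes nothing: in the simply connected `Y`
the path inside the cell is unique up to homotopy, so it can be replaced by one coming from `Y'`.
This compares a closed cell with its faces. -/
theorem reach_comp [SimplyConnectedSpace Y] [PathConnectedSpace Y'] (hc : Continuous c)
    {m : Y' → Y} (hm : Continuous m) (b' y' : Y') :
    reach x (fun y => c (m y)) b' u y' = reach x c (m b') u (m y') := by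
  apply Set.Subset.antisymm
  · rintro _ ⟨p, α, κ, hκ, rfl⟩
    exact ⟨p, α.map hm, κ, hκ, rfl⟩
  · rintro _ ⟨p, α, κ, hκ, rfl⟩
    let α' := PathConnectedSpace.somePath b' y'
    have h0 : pt u = c (m b') := by rw [← κ.source, hκ, α.source]
    let κ' : Path (pt u) (c (m y')) := ((α'.map hm).map hc).cast h0 rfl
    refine ⟨p, α', κ', fun s => rfl, ?_⟩
    rw [mk_eq_of_factor hc α (α'.map hm) κ κ' hκ fun s => rfl]

end Reach

theorem mem_reach_vertex {x v : K.V} (β : Path.Homotopic.Quotient (pt x) (pt v)) :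
    (⟨pt v, β⟩ : Σ z, Path.Homotopic.Quotient (pt x) z) ∈ reach x (fun _ : Unit => pt v) () v () ↔
      ∃ p : K.EdgePath x v, β = edgeClass p := by
  constructor
  · rintro ⟨p, α, κ, hκ, h⟩
    refine ⟨p, ?_⟩
    obtain rfl : κ = Path.refl (pt v) := Path.ext (funext hκ)
    simpa using h
  · rintro ⟨p, rfl⟩
    refine ⟨p, Path.refl (), Path.refl (pt v), fun s => rfl, ?_⟩
    rw [Path.Homotopic.Quotient.mk_refl, Path.Homotopic.Quotient.trans_refl]

theorem edgeClass_edge (e : K.E) :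
    edgeClass (.fwd e (.nil _) : K.EdgePath _ _) = .mk (edgePath e) := by
  rw [edgeClass_fwd, edgeClass_nil, Path.Homotopic.Quotient.trans_refl]

theorem edgeClass_edge_symm (e : K.E) :
    edgeClass (.bwd e (.nil _) : K.EdgePath _ _) = .mk (edgePath e).symm := by
  rw [edgeClass_bwd, edgeClass_nil, Path.Homotopic.Quotient.trans_refl,
    Path.Homotopic.Quotient.mk_symm]

/-- An arc is one edge in either direction, or constant when the boundary word is empty. Describing
`κ` by its values avoids casts between equal end points. -/
theorem exists_edgeClass_arc (f : K.F) {i : ℕ} (hi : i < numArcs f) :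
    ∃ q : K.EdgePath (corner f i) (corner f (i + 1)),
      ∀ κ : Path (pt (corner f i)) (pt (corner f (i + 1))), (∀ s, κ s = facePt f i 1 s) →
        Path.Homotopic.Quotient.mk κ = edgeClass q := by
  simp only [facePt_one f hi]
  unfold arcVal corner
  split_ifs with h h1
  · rw [← OrientedGraph.EdgePath.start_word _ _ h, ← OrientedGraph.EdgePath.finish_word _ _ h]
    generalize (K.bdry f).word[i] = a at *
    obtain ⟨e, s⟩ := a
    obtain rfl : s = 1 := h1
    refine ⟨.fwd e (.nil _), fun κ hκ => ?_⟩
    exact (congrArg Path.Homotopic.Quotient.mk (Path.ext (funext hκ))).trans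
      (edgeClass_edge e).symm
  · rw [← OrientedGraph.EdgePath.start_word _ _ h, ← OrientedGraph.EdgePath.finish_word _ _ h]
    generalize (K.bdry f).word[i] = a at *
    obtain ⟨e, s⟩ := a
    obtain rfl : s = -1 := (Int.units_eq_one_or s).resolve_left h1
    refine ⟨.bwd e (.nil _), fun κ hκ => ?_⟩
    exact (congrArg Path.Homotopic.Quotient.mk (Path.ext (funext hκ))).trans
      (edgeClass_edge_symm e).symm
  · have h0 := word_eq_nil_of_le hi h
    rw [OrientedGraph.EdgePath.vert_of_word_eq_nil _ h0, OrientedGraph.EdgePath.vert_of_word_eq_nil _ h0]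
    refine ⟨.nil _, fun κ hκ => ?_⟩
    rw [edgeClass_nil, ← Path.Homotopic.Quotient.mk_refl]
    congr 1
    exact Path.ext (funext hκ)

end CombinatorialComplex

/-! ### Gluing reachability across cells, and cellular paths -/

namespace CombinatorialComplex

variable {K : CombinatorialComplex.{u}}

/-- The points of a 2-cell as a function on the square. -/
noncomputable def faceFun (f : K.F) (i : ℕ) (p : I × I) : K.Space := facePt f i p.1 p.2

theorem continuous_faceFun (f : K.F) (i : ℕ) : Continuous (faceFun f i) := continuous_facePt f i

theorem reach_src (x : K.V) (e : K.E) :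
    reach x (edgePt e) 0 (K.src e) 0 = reach x (fun _ : Unit => pt (K.src e)) () (K.src e) () := by
  have h := reach_comp (x := x) (u := K.src e) (continuous_edgePt e)
    (m := fun _ : Unit => (0 : I)) continuous_const () ()
  rw [← h]
  congr 1
  funext _
  exact edgePt_zero e

theorem reach_edge_base (x : K.V) (e : K.E) (t : I) :
    reach x (edgePt e) 0 (K.src e) t = reach x (edgePt e) 1 (K.tgt e) t :=
  reach_change_base (.fwd e (.nil _)) ⟨ContinuousMap.id I, rfl, rfl⟩ (edgePath e) (fun _ => rfl)
    (edgeClass_edge e).symm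

theorem reach_tgt (x : K.V) (e : K.E) :
    reach x (edgePt e) 0 (K.src e) 1 = reach x (fun _ : Unit => pt (K.tgt e)) () (K.tgt e) () := by
  have h := reach_comp (x := x) (u := K.tgt e) (continuous_edgePt e)
    (m := fun _ : Unit => (1 : I)) continuous_const () ()
  rw [reach_edge_base, ← h]
  congr 1
  funext _
  exact edgePt_one e

theorem reach_bdry (x : K.V) (f : K.F) {i : ℕ} (hi : i < numArcs f) (t : I) :
    reach x (faceFun f i) (1, 0) (corner f i) (1, t) =
      arcVal (fun v => reach x (fun _ : Unit => pt v) () v ())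
        (fun e t => reach x (edgePt e) 0 (K.src e) t) f i t := by
  have hm : Continuous fun t : I => ((1 : I), t) := by fun_prop
  have hm' : Continuous fun t : I => ((1 : I), σ t) := by fun_prop
  have h1 := facePt_one f hi
  unfold arcVal at h1 ⊢
  unfold corner
  split_ifs at h1 ⊢ with h h2
  · rw [← OrientedGraph.EdgePath.start_word _ _ h, OrientedGraph.start, if_pos h2,
      ← reach_comp (continuous_faceFun f i) hm 0 t]
    congr 1
    exact funext h1
  · have h3 := reach_comp (x := x) (u := K.tgt (K.bdry f).word[i].1) (continuous_faceFun f i) hm'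
      1 (σ t)
    rw [symm_one, symm_symm] at h3
    rw [← OrientedGraph.EdgePath.start_word _ _ h, OrientedGraph.start, if_neg h2, ← h3]
    refine Eq.trans ?_ (reach_edge_base x _ (σ t)).symm
    congr 1
    funext t
    exact (h1 (σ t)).trans (by rw [symm_symm])
  · rw [OrientedGraph.EdgePath.vert_of_word_eq_nil _ (word_eq_nil_of_le hi h)]
    have h3 := reach_comp (x := x) (c := fun _ : Unit => pt (K.base f)) (u := K.base f)
      continuous_const (m := fun _ : I => ()) continuous_const 0 t
    rw [← reach_comp (continuous_faceFun f i) hm 0 t]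
    refine Eq.trans ?_ h3
    congr 1
    exact funext h1

/-- The two sectors have different base corners. The base is first moved along the arc between them;
then both sides restrict to the common radius. -/
theorem reach_rad (x : K.V) (f : K.F) {i : ℕ} (hi : i < numArcs f) (ρ : I) :
    reach x (faceFun f i) (1, 0) (corner f i) (ρ, 1) =
      reach x (faceFun f ((i + 1) % numArcs f)) (1, 0) (corner f ((i + 1) % numArcs f)) (ρ, 0) := by
  obtain ⟨q, hq⟩ := exists_edgeClass_arc f hi
  have hm : Continuous fun ρ : I => (ρ, (1 : I)) := by fun_prop
  have hm' : Continuous fun ρ : I => (ρ, (0 : I)) := by fun_prop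
  have hp : Continuous fun t : I => ((1 : I), t) := by fun_prop
  let ε : Path ((1 : I), (0 : I)) (1, 1) := ⟨⟨fun t => (1, t), hp⟩, rfl, rfl⟩
  let κ : Path (pt (corner f i)) (pt (corner f (i + 1))) :=
    (ε.map (continuous_faceFun f i)).cast
      (((facePt_one f hi 0).trans (arcVal_zero edgePt_zero edgePt_one f hi)).symm)
      (((facePt_one f hi 1).trans (arcVal_one edgePt_zero edgePt_one f hi)).symm)
  rw [reach_change_base q ε κ (fun _ => rfl) (hq κ fun _ => rfl),
    ← reach_comp (continuous_faceFun f i) hm 1 ρ, corner_succ_mod f hi,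
    ← reach_comp (continuous_faceFun f _) hm' 1 ρ]
  congr 1
  funext ρ
  exact facePt_rad f hi ρ

theorem reach_cen (x : K.V) (f : K.F) (i : ℕ) (t : I) :
    reach x (faceFun f i) (1, 0) (corner f i) (0, t) =
      reach x (faceFun f i) (1, 0) (corner f i) (0, 0) := by
  have hp : Continuous fun t : I => ((0 : I), t) := by fun_prop
  refine reach_eq_of_const ((PathConnectedSpace.somePath t 0).map hp) fun s => ?_
  exact facePt_zero f i i _ _

theorem exists_reachable (x : K.V) :
    ∃ D : K.Space → Set (Σ z : K.Space, Path.Homotopic.Quotient (pt x) z),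
      (∀ v, D (pt v) = reach x (fun _ : Unit => pt v) () v ()) ∧
      (∀ e t, D (edgePt e t) = reach x (edgePt e) 0 (K.src e) t) ∧
      ∀ f, ∀ i < numArcs f, ∀ ρ t,
        D (facePt f i ρ t) = reach x (faceFun f i) (1, 0) (corner f i) (ρ, t) :=
  Compatible.exists_lift
    { src := reach_src x
      tgt := reach_tgt x
      bdry := fun f _ hi t => reach_bdry x f hi t
      rad := fun f _ hi ρ => reach_rad x f hi ρ
      cen := fun f i _ t => reach_cen x f i t }

/-- The classes of paths from `x` to a point which run along edges and then inside a closed cell. -/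
noncomputable def reachable (x : K.V) (y : K.Space) :
    Set (Σ z : K.Space, Path.Homotopic.Quotient (pt x) z) := (exists_reachable x).choose y

/-- A class of paths is cellular if composition with it preserves reachability along edges. -/
def IsCellular {y z : K.Space} (α : Path.Homotopic.Quotient y z) : Prop :=
  ∀ (x : K.V) (β : Path.Homotopic.Quotient (pt x) y),
    ⟨y, β⟩ ∈ reachable x y ↔ ⟨z, β.trans α⟩ ∈ reachable x z

namespace IsCellular

theorem refl (y : K.Space) : IsCellular (.refl y : Path.Homotopic.Quotient y y) := by
  intro x β
  rw [Path.Homotopic.Quotient.trans_refl]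

theorem trans {y z w : K.Space} {α : Path.Homotopic.Quotient y z}
    {α' : Path.Homotopic.Quotient z w} (h : IsCellular α) (h' : IsCellular α') :
    IsCellular (α.trans α') := by
  intro x β
  rw [h x, h' x, Path.Homotopic.Quotient.trans_assoc]

theorem symm {y z : K.Space} {α : Path.Homotopic.Quotient y z} (h : IsCellular α) :
    IsCellular α.symm := by
  intro x β
  rw [h x (β.trans α.symm), trans_symm_trans]

theorem congr {y z y' z' : K.Space} {κ : Path y z} {κ' : Path y' z'}
    (h : IsCellular (.mk κ)) (hκ : ∀ s, κ s = κ' s) : IsCellular (.mk κ') := by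
  obtain rfl : y = y' := by rw [← κ.source, hκ, κ'.source]
  obtain rfl : z = z' := by rw [← κ.target, hκ, κ'.target]
  obtain rfl : κ = κ' := Path.ext (funext hκ)
  exact h

theorem of_const {y z : K.Space} (κ : Path y z) (h : ∀ s, κ s = y) : IsCellular (.mk κ) := by
  have h1 : IsCellular (.mk (Path.refl y)) := by
    rw [Path.Homotopic.Quotient.mk_refl]
    exact refl y
  exact h1.congr fun s => (h s).symm

theorem of_edge (e : K.E) {y z : K.Space} (κ : Path y z) {a b : I} (δ : Path a b)
    (h : ∀ s, κ s = edgePt e (δ s)) : IsCellular (.mk κ) := by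
  have h1 : IsCellular (.mk (δ.map (continuous_edgePt e))) := by
    intro x β
    rw [reachable, reachable, (exists_reachable x).choose_spec.2.1,
      (exists_reachable x).choose_spec.2.1]
    exact (trans_mem_reach_iff β δ (δ.map (continuous_edgePt e)) fun _ => rfl).symm
  exact h1.congr fun s => (h s).symm

theorem of_face (f : K.F) {i : ℕ} (hi : i < numArcs f) {y z : K.Space} (κ : Path y z)
    {a b : I × I} (δ : Path a b) (h : ∀ s, κ s = facePt f i (δ s).1 (δ s).2) :
    IsCellular (.mk κ) := by
  have h1 : IsCellular (.mk (δ.map (continuous_faceFun f i))) := by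
    intro x β
    have e : ∀ p : I × I, reachable x (faceFun f i p) =
        reach x (faceFun f i) (1, 0) (corner f i) p :=
      fun p => (exists_reachable x).choose_spec.2.2 f i hi p.1 p.2
    rw [e, e]
    exact (trans_mem_reach_iff β δ (δ.map (continuous_faceFun f i)) fun _ => rfl).symm
  exact h1.congr fun s => (h s).symm

end IsCellular

/-- A continuous map from the interval as a path. -/
def pathOf {X : Type*} [TopologicalSpace X] (τ : C(I, X)) : Path (τ 0) (τ 1) := ⟨τ, rfl, rfl⟩

/-- The four sides of a homotopy of paths with moving ends. -/
theorem mk_pathOf_square {X : Type*} [TopologicalSpace X] (F : C(I, C(I, X))) :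
    Path.Homotopic.Quotient.mk (pathOf ⟨fun t => F t 0, by fun_prop⟩) =
      ((Path.Homotopic.Quotient.mk (pathOf (F 0))).trans
        (.mk (pathOf ⟨fun t => F t 1, by fun_prop⟩))).trans
          (Path.Homotopic.Quotient.mk (pathOf (F 1))).symm := by
  have hc : Continuous fun p : I × I => F p.1 p.2 := by fun_prop
  have h0 : Continuous fun t : I => (t, (0 : I)) := by fun_prop
  have h1 : Continuous fun t : I => (t, (1 : I)) := by fun_prop
  have h2 : Continuous fun t : I => ((0 : I), t) := by fun_prop
  have h3 : Continuous fun t : I => ((1 : I), t) := by fun_prop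
  rw [← Path.Homotopic.Quotient.mk_trans, ← Path.Homotopic.Quotient.mk_symm,
    ← Path.Homotopic.Quotient.mk_trans]
  refine mk_eq_of_factor hc (pathOf ⟨_, h0⟩)
    (((pathOf ⟨_, h2⟩).trans (pathOf ⟨_, h1⟩)).trans (pathOf ⟨_, h3⟩).symm) _ _ (fun _ => rfl) ?_
  intro s
  simp only [Path.trans_apply]
  split_ifs <;> rfl

/-- The paths `H (δ t)` sweep out a square. Two opposite sides are cellular by `hcell`, so
cellularity of one remaining side follows from that of the other. -/
theorem IsCellular.of_square {U : Set K.Space} {H : K.Space → C(I, K.Space)}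
    (hH : ContinuousOn H U) (hcell : ∀ y ∈ U, IsCellular (.mk (pathOf (H y))))
    (δ : C(I, K.Space)) (hδ : ∀ t, δ t ∈ U)
    (htop : ∀ τ : C(I, K.Space), (∀ t, τ t = H (δ t) 1) → IsCellular (.mk (pathOf τ)))
    (τ : C(I, K.Space)) (hτ : ∀ t, τ t = H (δ t) 0) : IsCellular (.mk (pathOf τ)) := by
  have hF : Continuous fun t => H (δ t) := hH.comp_continuous δ.continuous hδ
  have h := mk_pathOf_square ⟨_, hF⟩
  have h1 : IsCellular (.mk (pathOf ⟨fun t => H (δ t) 0, (continuous_eval_const 0).comp hF⟩)) := by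
    refine h ▸ ?_
    exact ((hcell _ (hδ 0)).trans (htop _ fun _ => rfl)).trans (hcell _ (hδ 1)).symm
  exact h1.congr fun s => (hτ s).symm

end CombinatorialComplex

/-! ### Local contractions and reduction to edge paths -/

namespace CombinatorialComplex

variable {K : CombinatorialComplex.{u}}

theorem arcVal_imp {Z : Type*} {zV : K.V → Z} {zE : K.E → I → Z} {sV : K.V → Prop}
    {sE : K.E → I → Prop} {P : Z → K.Space → Prop} (hV : ∀ v, sV v → P (zV v) (pt v))
    (hE : ∀ e t, sE e t → P (zE e t) (edgePt e t)) {f : K.F} {i : ℕ} (hi : i < numArcs f) {t : I}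
    (h : arcVal sV sE f i t) : P (arcVal zV zE f i t) (facePt f i 1 t) := by
  rw [facePt_one f hi]
  unfold arcVal at *
  split_ifs at *
  · exact hE _ _ h
  · exact hE _ _ h
  · exact hV _ h

/-- The radial paths from the points of a 2-cell to its boundary. -/
noncomputable def radial (f : K.F) (i : ℕ) : C(I × I, C(I, K.Space)) :=
  -- The radius 1 - (1 - s)(1 - ρ) goes from ρ at s = 0 to 1 at s = 1, and stays 1 if ρ = 1.
  ContinuousMap.curry ⟨fun p => facePt f i (σ (σ p.2 * σ p.1.1)) p.1.2, by
    exact (continuous_facePt f i).comp (g := fun p : I × I => facePt f i p.1 p.2)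
      (f := fun p : (I × I) × I => (σ (σ p.2 * σ p.1.1), p.1.2)) (by fun_prop)⟩

theorem radial_apply (f : K.F) (i : ℕ) (p : I × I) (s : I) :
    radial f i p s = facePt f i (σ (σ s * σ p.1)) p.2 := rfl

open Classical in
/-- The radial contraction of the punctured 2-cells to their boundaries. -/
theorem exists_radial (K : CombinatorialComplex.{u}) : ∃ H : K.Space → C(I, K.Space),
    (∀ v, H (pt v) = .const I (pt v)) ∧ (∀ e t, H (edgePt e t) = .const I (edgePt e t)) ∧
      ∀ f, ∀ i < numArcs f, ∀ ρ t, H (facePt f i ρ t) =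
        if ρ = 0 then .const I (facePt f 0 0 0) else radial f i (ρ, t) := by
  refine Compatible.exists_lift
    { src := fun e => by rw [edgePt_zero]
      tgt := fun e => by rw [edgePt_one]
      bdry := fun f i hi t => ?_
      rad := fun f i hi ρ => ?_
      cen := fun f i hi t => by simp }
  · rw [if_neg one_ne_zero, arcVal_comp (ContinuousMap.const I), ← facePt_one f hi]
    ext s
    simp [radial_apply]
  · congr 1
    ext s
    exact facePt_rad f hi _

-- A contraction in two stages: `H` pushes 2-cells radially to their boundary, then `k` follows the
-- given contraction of the 1-skeleton to `c`. Each track stays in one closed cell or follows a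
-- given cellular path. Two applications of `IsCellular.of_square` reduce any path in `U` to a
-- constant one.
open Classical in
theorem isCellular_of_skeleton {U : Set K.Space} (hU : IsOpen U) {sV : K.V → Prop}
    {sE : K.E → I → Prop} (hUV : ∀ v, pt v ∈ U ↔ sV v) (hUE : ∀ e t, edgePt e t ∈ U ↔ sE e t)
    (hUF : ∀ f, ∀ i < numArcs f, ∀ ρ t, facePt f i ρ t ∈ U ↔ 0 < ρ ∧ arcVal sV sE f i t)
    {kV : K.V → C(I, K.Space)} {kE : K.E → I → C(I, K.Space)}
    (hs : ∀ e, kE e 0 = kV (K.src e)) (ht : ∀ e, kE e 1 = kV (K.tgt e))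
    (hcont : ∀ e, ContinuousOn (kE e) {t | sE e t}) (c : K.Space)
    (hV : ∀ v, sV v → kV v 0 = pt v ∧ kV v 1 = c ∧ IsCellular (.mk (pathOf (kV v))))
    (hE : ∀ e t, sE e t →
      kE e t 0 = edgePt e t ∧ kE e t 1 = c ∧ IsCellular (.mk (pathOf (kE e t))))
    (τ : C(I, K.Space)) (hτ : ∀ t, τ t ∈ U) : IsCellular (.mk (pathOf τ)) := by
  obtain ⟨H, HV, HE, HF⟩ := exists_radial K
  have hc : Compatible kV kE (fun f i ρ t => if ρ = 0 then .const I (facePt f 0 0 0)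
      else arcVal kV kE f i t) :=
    { src := hs
      tgt := ht
      bdry := fun f i hi t => by simp
      rad := fun f i hi ρ => by rw [arcVal_one_eq_zero hs ht f hi]
      cen := fun f i hi t => by simp }
  obtain ⟨k, KV, KE, KF⟩ := hc.exists_lift
  have hHc : ContinuousOn H U := by
    refine continuousOn_space hU (fun e => ?_) fun f i hi => ?_
    · simp only [HE]
      exact (ContinuousMap.const'.continuous.comp (continuous_edgePt e)).continuousOn
    · simp only [HF f i hi, hUF f i hi]
      refine (radial f i).continuous.continuousOn.congr ?_
      rintro ⟨ρ, t⟩ ⟨hρ, -⟩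
      exact if_neg (unitInterval.pos_iff_ne_zero.1 hρ)
  have hkc : ContinuousOn k U := by
    refine continuousOn_space hU (fun e => ?_) fun f i hi => ?_
    · simp only [KE, hUE]
      exact hcont e
    · simp only [KF f i hi, hUF f i hi]
      refine ((continuousOn_arcVal (zV := kV) (sV := sV) hcont f i).comp
        continuous_snd.continuousOn fun p hp => hp.2).congr ?_
      rintro ⟨ρ, t⟩ ⟨hρ, -⟩
      exact if_neg (unitInterval.pos_iff_ne_zero.1 hρ)
  have hH : ∀ y ∈ U, H y 0 = y ∧ IsCellular (.mk (pathOf (H y))) := by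
    intro y hy
    rcases y.cases with ⟨v, rfl⟩ | ⟨e, t, rfl⟩ | ⟨f, i, hi, ρ, t, rfl⟩
    · rw [HV]
      exact ⟨rfl, .of_const _ fun _ => rfl⟩
    · rw [HE]
      exact ⟨rfl, .of_const _ fun _ => rfl⟩
    · rw [HF f i hi, if_neg (unitInterval.pos_iff_ne_zero.1 ((hUF f i hi ρ t).1 hy).1)]
      refine ⟨by simp [radial_apply], IsCellular.of_face f hi _
        (pathOf ⟨fun s => (σ (σ s * σ ρ), t), by fun_prop⟩) fun _ => rfl⟩
  have hk : ∀ y ∈ U, k y 0 = H y 1 ∧ k y 1 = c ∧ IsCellular (.mk (pathOf (k y))) := by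
    intro y hy
    rcases y.cases with ⟨v, rfl⟩ | ⟨e, t, rfl⟩ | ⟨f, i, hi, ρ, t, rfl⟩
    · rw [HV, KV]
      exact hV v ((hUV v).1 hy)
    · rw [HE, KE]
      exact hE e t ((hUE e t).1 hy)
    · obtain ⟨h1, h2⟩ := (hUF f i hi ρ t).1 hy
      have h3 := unitInterval.pos_iff_ne_zero.1 h1
      rw [HF f i hi, KF f i hi, if_neg h3, if_neg h3]
      have h4 := arcVal_imp (P := fun κ y => κ 0 = y ∧ κ 1 = c ∧ IsCellular (.mk (pathOf κ)))
        hV hE hi h2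
      have h5 : radial f i (ρ, t) 1 = facePt f i 1 t := by simp [radial_apply]
      rw [h5]
      exact h4
  refine IsCellular.of_square hHc (fun y hy => (hH y hy).2) τ hτ (fun τ' hτ' => ?_) τ
    fun t => ((hH _ (hτ t)).1).symm
  refine IsCellular.of_square hkc (fun y hy => (hk y hy).2.2) τ hτ (fun τ'' hτ'' => ?_) τ'
    fun t => (hτ' t).trans ((hk _ (hτ t)).1).symm
  refine .of_const _ fun s => ?_
  change τ'' s = τ'' 0
  rw [hτ'', hτ'', (hk _ (hτ _)).2.1, (hk _ (hτ _)).2.1]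

/-- The paths along an edge to its source. -/
noncomputable def toSrc (e : K.E) : C(I, C(I, K.Space)) :=
  ContinuousMap.curry ⟨fun p => edgePt e (σ p.2 * p.1),
    (continuous_edgePt e).comp (by fun_prop)⟩

theorem toSrc_apply (e : K.E) (t s : I) : toSrc e t s = edgePt e (σ s * t) := rfl

/-- The paths along an edge to its target. -/
noncomputable def toTgt (e : K.E) : C(I, C(I, K.Space)) :=
  ContinuousMap.curry ⟨fun p => edgePt e (σ (σ p.2 * σ p.1)),
    (continuous_edgePt e).comp (by fun_prop)⟩

theorem toTgt_apply (e : K.E) (t s : I) : toTgt e t s = edgePt e (σ (σ s * σ t)) := rfl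

theorem isCellular_toSrc (e : K.E) (t : I) : IsCellular (.mk (pathOf (toSrc e t))) :=
  .of_edge e _ (pathOf ⟨fun s => σ s * t, by fun_prop⟩) fun _ => rfl

theorem isCellular_toTgt (e : K.E) (t : I) : IsCellular (.mk (pathOf (toTgt e t))) :=
  .of_edge e _ (pathOf ⟨fun s => σ (σ s * σ t), by fun_prop⟩) fun _ => rfl

/-- The paths in a 2-cell to its center. -/
noncomputable def toCenter (f : K.F) (i : ℕ) : C(I × I, C(I, K.Space)) :=
  ContinuousMap.curry ⟨fun p => facePt f i (σ p.2 * p.1.1) p.1.2, by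
    exact (continuous_facePt f i).comp (g := fun p : I × I => facePt f i p.1 p.2)
      (f := fun p : (I × I) × I => (σ p.2 * p.1.1, p.1.2)) (by fun_prop)⟩

theorem toCenter_apply (f : K.F) (i : ℕ) (p : I × I) (s : I) :
    toCenter f i p s = facePt f i (σ s * p.1) p.2 := rfl

open Classical in
theorem exists_isOpen_isCellular_vertex (v : K.V) : ∃ U : Set K.Space, IsOpen U ∧ pt v ∈ U ∧
    ∀ τ : C(I, K.Space), (∀ t, τ t ∈ U) → IsCellular (.mk (pathOf τ)) := by
  obtain ⟨U, hU, hUV, hUE, hUF⟩ := exists_isOpen_star v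
  refine ⟨U, hU, (hUV v).2 rfl, isCellular_of_skeleton hU hUV hUE hUF
    (kV := fun u => .const I (pt u))
    (kE := fun e t => if (t : ℝ) < 1 / 2 then toSrc e t else toTgt e t) ?_ ?_ ?_ (pt v) ?_ ?_⟩
  · intro e
    rw [if_pos (by simp)]
    ext s
    simp [toSrc_apply, edgePt_zero]
  · intro e
    rw [if_neg (by rw [Set.Icc.coe_one]; norm_num)]
    ext s
    simp [toTgt_apply, edgePt_one]
  · intro e t ht
    apply ContinuousAt.continuousWithinAt
    rcases ht with ⟨ht, -⟩ | ⟨ht, -⟩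
    · refine (toSrc e).continuous.continuousAt.congr ?_
      filter_upwards [(isOpen_lt continuous_subtype_val continuous_const).mem_nhds ht] with r hr
      exact (if_pos hr).symm
    · refine (toTgt e).continuous.continuousAt.congr ?_
      filter_upwards [(isOpen_lt continuous_const continuous_subtype_val).mem_nhds ht] with r hr
      exact (if_neg (not_lt.2 hr.le)).symm
  · rintro u rfl
    exact ⟨rfl, rfl, .of_const _ fun _ => rfl⟩
  · rintro e t (⟨ht, rfl⟩ | ⟨ht, rfl⟩)
    · rw [if_pos ht]
      exact ⟨by simp [toSrc_apply], by simp [toSrc_apply, edgePt_zero], isCellular_toSrc e t⟩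
    · rw [if_neg (not_lt.2 ht.le)]
      exact ⟨by simp [toTgt_apply], by simp [toTgt_apply, edgePt_one], isCellular_toTgt e t⟩

open Classical in
theorem exists_isOpen_isCellular_edge (e : K.E) {t : I} (h0 : 0 < t) (h1 : t < 1) :
    ∃ U : Set K.Space, IsOpen U ∧ edgePt e t ∈ U ∧
      ∀ τ : C(I, K.Space), (∀ t, τ t ∈ U) → IsCellular (.mk (pathOf τ)) := by
  obtain ⟨U, hU, hUV, hUE, hUF⟩ := exists_isOpen_interior e
  -- The interior of the edge is contracted to its source; the tracks may leave `U`. The value at t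
  -- = 1 lies outside `U` and only serves compatibility at the target.
  refine ⟨U, hU, (hUE e t).2 ⟨rfl, h0, h1⟩, isCellular_of_skeleton hU hUV hUE hUF
    (kV := fun u => .const I (pt u))
    (kE := fun e t => if t = 1 then .const I (edgePt e 1) else toSrc e t)
    ?_ ?_ ?_ (pt (K.src e)) ?_ ?_⟩
  · intro e
    rw [if_neg zero_ne_one]
    ext s
    simp [toSrc_apply, edgePt_zero]
  · intro e
    rw [if_pos rfl, edgePt_one]
  · intro e
    refine (toSrc e).continuous.continuousOn.congr ?_
    rintro t ⟨-, -, ht⟩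
    exact if_neg ht.ne
  · exact fun u hu => hu.elim
  · rintro e t ⟨rfl, -, ht⟩
    rw [if_neg ht.ne]
    exact ⟨by simp [toSrc_apply], by simp [toSrc_apply, edgePt_zero], isCellular_toSrc _ t⟩

open Classical in
theorem exists_isOpen_isCellular_face (f : K.F) {i : ℕ} (hi : i < numArcs f) {ρ : I} (hρ : ρ < 1)
    (t : I) : ∃ U : Set K.Space, IsOpen U ∧ facePt f i ρ t ∈ U ∧
      ∀ τ : C(I, K.Space), (∀ t, τ t ∈ U) → IsCellular (.mk (pathOf τ)) := by
  obtain ⟨U, hU, hUV, hUE, hUF⟩ := exists_isOpen_disk f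
  -- The open disk contracts to its center. The constant paths on the boundary, where the map need
  -- not be continuous, only make it well defined.
  have hc : Compatible (K := K) (fun v => ContinuousMap.const I (pt v))
      (fun e t => ContinuousMap.const I (edgePt e t))
      (fun f i ρ t => if ρ = 1 then .const I (facePt f i 1 t) else toCenter f i (ρ, t)) :=
    { src := fun e => by rw [edgePt_zero]
      tgt := fun e => by rw [edgePt_one]
      bdry := fun f i hi t => by
        rw [if_pos rfl, arcVal_comp (ContinuousMap.const I), ← facePt_one f hi]
      rad := fun f i hi ρ => by
        rw [facePt_rad f hi]
        congr 1
        ext s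
        exact facePt_rad f hi _
      cen := fun f i hi t => by
        rw [if_neg zero_ne_one, if_neg zero_ne_one]
        ext s
        simp only [toCenter_apply, mul_zero]
        exact facePt_zero f i i _ _ }
  obtain ⟨H, HV, HE, HF⟩ := hc.exists_lift
  have hHc : ContinuousOn H U := by
    refine continuousOn_space hU (fun e => ?_) fun f i hi => ?_
    · simp only [HE]
      exact (ContinuousMap.const'.continuous.comp (continuous_edgePt e)).continuousOn
    · simp only [HF f i hi, hUF f i hi]
      refine (toCenter f i).continuous.continuousOn.congr ?_
      rintro ⟨ρ, t⟩ ⟨-, hρ⟩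
      exact if_neg hρ.ne
  have hH : ∀ y ∈ U, H y 0 = y ∧ H y 1 = facePt f 0 0 0 ∧ IsCellular (.mk (pathOf (H y))) := by
    intro y hy
    rcases y.cases with ⟨v, rfl⟩ | ⟨e, t, rfl⟩ | ⟨f', j, hj, ρ, t, rfl⟩
    · exact (hUV v hy).elim
    · exact (hUE e t hy).elim
    · obtain ⟨rfl, hρ⟩ := (hUF f' j hj ρ t).1 hy
      rw [HF f' j hj, if_neg hρ.ne]
      refine ⟨by simp [toCenter_apply], ?_, IsCellular.of_face f' hj _
        (pathOf ⟨fun s => (σ s * ρ, t), by fun_prop⟩) fun _ => rfl⟩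
      simp only [toCenter_apply, symm_one, zero_mul]
      exact facePt_zero f' _ _ _ _
  refine ⟨U, hU, (hUF f i hi ρ t).2 ⟨rfl, hρ⟩, fun τ hτ => ?_⟩
  refine IsCellular.of_square hHc (fun y hy => (hH y hy).2.2) τ hτ (fun τ' hτ' => ?_) τ
    fun t => ((hH _ (hτ t)).1).symm
  refine .of_const _ fun s => ?_
  change τ' s = τ' 0
  rw [hτ', hτ', (hH _ (hτ _)).2.1, (hH _ (hτ _)).2.1]

theorem exists_isOpen_isCellular (y : K.Space) : ∃ U : Set K.Space, IsOpen U ∧ y ∈ U ∧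
    ∀ τ : C(I, K.Space), (∀ t, τ t ∈ U) → IsCellular (.mk (pathOf τ)) := by
  rcases y.cases_interior with ⟨v, rfl⟩ | ⟨e, t, h0, h1, rfl⟩ | ⟨f, i, hi, ρ, t, hρ, rfl⟩
  · exact exists_isOpen_isCellular_vertex v
  · exact exists_isOpen_isCellular_edge e h0 h1
  · exact exists_isOpen_isCellular_face f hi hρ t

/-- Subdivide the path by the Lebesgue number lemma, so that each piece lies in a neighbourhood
whose paths are all cellular, and compose. -/
theorem isCellular {y z : K.Space} (α : Path.Homotopic.Quotient y z) : IsCellular α := by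
  induction α using Path.Homotopic.Quotient.ind with
  | _ γ =>
  choose U hU hmem hcell using exists_isOpen_isCellular (K := K)
  obtain ⟨t, ht0, htm, ⟨N, hN⟩, ht⟩ := exists_monotone_Icc_subset_open_cover_unitInterval
    (c := fun y => γ ⁻¹' U y) (fun y => (hU y).preimage γ.continuous)
    (fun s _ => Set.mem_iUnion.2 ⟨γ s, hmem _⟩)
  -- Any parametrization from 0 to `t n` may be used, since all such paths in the interval are
  -- homotopic.
  have key : ∀ n, ∀ δ : Path (0 : I) (t n), IsCellular (.mk (δ.map γ.continuous)) := by
    intro n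
    induction n with
    | zero =>
      intro δ
      have h1 : Path.Homotopic.Quotient.mk (δ.map γ.continuous) =
          .mk ((Path.refl (0 : I)).map γ.continuous |>.cast rfl (by rw [ht0])) :=
        mk_eq_of_factor γ.continuous δ ((Path.refl (0 : I)).cast rfl ht0) _ _ (fun _ => rfl)
          fun _ => rfl
      rw [h1]
      exact .of_const _ fun _ => rfl
    | succ n ih =>
      intro δ
      obtain ⟨y, hy⟩ := ht n
      let δ0 : Path (0 : I) (t n) := PathConnectedSpace.somePath _ _
      have hle : t n ≤ t (n + 1) := htm n.le_succ
      -- This path stays between its end points, hence in the piece covered by one neighbourhood.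
      let δ1 : Path (t n) (t (n + 1)) :=
        { toFun := fun s => max (t n) (s * t (n + 1))
          continuous_toFun := by fun_prop
          source' := by simp
          target' := by simp [hle] }
      have h1 : Path.Homotopic.Quotient.mk (δ.map γ.continuous) =
          (Path.Homotopic.Quotient.mk (δ0.map γ.continuous)).trans
            (.mk (δ1.map γ.continuous)) := by
        rw [← Path.Homotopic.Quotient.mk_trans]
        refine mk_eq_of_factor γ.continuous δ (δ0.trans δ1) _ _ (fun _ => rfl) fun s => ?_
        rw [← Path.map_trans]
        rfl
      rw [h1]
      refine (ih δ0).trans ?_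
      have h2 : IsCellular (.mk (pathOf ⟨fun s => γ (δ1 s), by fun_prop⟩)) := by
        refine hcell y _ fun s => hy ⟨le_max_left _ _, max_le hle ?_⟩
        exact mul_le_of_le_one_left' s.2.2
      exact h2.congr fun _ => rfl
  have h := key N ((pathOf (ContinuousMap.id I)).cast rfl (hN N le_rfl))
  exact h.congr fun _ => rfl

/-- Every path between vertices is homotopic to an edge path. -/
theorem exists_edgeClass {x v : K.V} (β : Path.Homotopic.Quotient (pt x) (pt v)) :
    ∃ p : K.EdgePath x v, β = edgeClass p := by
  rw [← mem_reach_vertex, ← (exists_reachable x).choose_spec.1]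
  -- The constant path at `x` is reachable, and cellularity carries this along `β`.
  have h := (isCellular β x (.refl _)).1 (by
    rw [reachable, (exists_reachable x).choose_spec.1, mem_reach_vertex]
    exact ⟨.nil x, (edgeClass_nil x).symm⟩)
  rwa [Path.Homotopic.Quotient.refl_trans] at h

end CombinatorialComplex

namespace CombinatorialComplex

variable {K : CombinatorialComplex.{u}}

/-! ### Boundaries of 2-cells are null-homotopic -/

/-- Here the index is not reduced modulo the number of arcs, which suits an induction along the
boundary word. -/
theorem polar_succ_zero (f : K.F) {i : ℕ} (hi : i < numArcs f) (ρ : I) :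
    polar (numArcs f) (i + 1) ρ 0 = polar (numArcs f) i ρ 1 := by
  rw [polar_one_eq_zero (numArcs_pos f) hi]
  rcases Nat.lt_or_ge (i + 1) (numArcs f) with h | h
  · rw [Nat.mod_eq_of_lt h]
  · have h1 : i + 1 = numArcs f := le_antisymm hi h
    rw [h1, Nat.mod_self]
    have h0 : ((numArcs f : ℕ) : ℂ) ≠ 0 := by exact_mod_cast (numArcs_pos f).ne'
    apply Subtype.ext
    simp only [polar, Set.Icc.coe_zero, Complex.ofReal_zero, add_zero, Nat.cast_zero, mul_zero,
      zero_div, Complex.exp_zero]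
    rw [mul_div_cancel_right₀ _ h0, Complex.exp_two_pi_mul_I]

/-- A point of a 2-cell. -/
def diskPt (f : K.F) (z : Metric.closedBall (0 : ℂ) 1) : K.Space := Quot.mk _ (faceCell f z)

theorem continuous_diskPt (f : K.F) : Continuous (diskPt f) := by
  refine continuous_quot_mk.comp ?_
  unfold faceCell
  exact continuous_inr.comp (continuous_inr.comp continuous_sigmaMk)

/-- The sector between two radii lies in a contractible disk, so an arc followed by the radius at
its end is homotopic to the radius at its start. -/
theorem trans_radius (f : K.F) {i : ℕ} (hi : i < numArcs f) {u u' : K.V}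
    (κa : Path (pt u) (pt u')) (ha : ∀ s, κa s = facePt f i 1 s)
    (κ : Path (pt u') (facePt f 0 0 0)) (hκ : ∀ s, κ s = facePt f (i + 1) (σ s) 0) :
    ∃ κ' : Path (pt u) (facePt f 0 0 0), (∀ s, κ' s = facePt f i (σ s) 0) ∧
      (Path.Homotopic.Quotient.mk κa).trans (.mk κ) = .mk κ' := by
  have : ContractibleSpace (Metric.closedBall (0 : ℂ) 1) :=
    (convex_closedBall (0 : ℂ) 1).contractibleSpace ⟨0, by simp⟩
  have hc := continuous_diskPt f
  have hp : ∀ i, Continuous fun p : I × I => polar (numArcs f) i p.1 p.2 := continuous_polar _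
  have h1 : Continuous fun s : I => polar (numArcs f) i 1 s :=
    (hp i).comp (f := fun s : I => ((1 : I), s)) (by fun_prop)
  have h2 : Continuous fun s : I => polar (numArcs f) (i + 1) (σ s) 0 :=
    (hp (i + 1)).comp (f := fun s : I => (σ s, (0 : I))) (by fun_prop)
  have h3 : Continuous fun s : I => polar (numArcs f) i (σ s) 0 :=
    (hp i).comp (f := fun s : I => (σ s, (0 : I))) (by fun_prop)
  have e0 : ∀ j, polar (numArcs f) j 0 0 = polar (numArcs f) 0 0 0 := by
    intro j
    apply Subtype.ext
    simp [polar]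
  let α1 : Path (polar (numArcs f) i 1 0) (polar (numArcs f) i 1 1) := ⟨⟨_, h1⟩, rfl, rfl⟩
  let α2 : Path (polar (numArcs f) i 1 1) (polar (numArcs f) 0 0 0) :=
    ⟨⟨_, h2⟩, by simp [polar_succ_zero f hi], by simp [e0]⟩
  let α3 : Path (polar (numArcs f) i 1 0) (polar (numArcs f) 0 0 0) :=
    ⟨⟨_, h3⟩, by simp, by simp [e0]⟩
  have hu : pt u = facePt f i 1 0 := by rw [← ha, κa.source]
  let κ' : Path (pt u) (facePt f 0 0 0) := (α3.map hc).cast hu rfl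
  refine ⟨κ', fun s => rfl, ?_⟩
  rw [← Path.Homotopic.Quotient.mk_trans]
  refine mk_eq_of_factor hc (α1.trans α2) α3 _ _ (fun s => ?_) fun s => rfl
  rw [Path.trans_apply, Path.trans_apply]
  split_ifs
  · exact ha _
  · exact hκ _

/-- Backward induction along an edge path. `P` depends on the position because the same edge may
occur several times in a boundary word, on different arcs. -/
theorem edgeClass_trans_induction {c : K.Space}
    {P : ℕ → ∀ u : K.V, Path.Homotopic.Quotient (pt u) c → Prop} {x w : K.V} (p : K.EdgePath x w)
    (hf : ∀ i e, p.word[i]? = some (e, 1) → ∀ β, P (i + 1) (K.tgt e) β →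
      P i (K.src e) ((Path.Homotopic.Quotient.mk (edgePath e)).trans β))
    (hb : ∀ i e, p.word[i]? = some (e, -1) → ∀ β, P (i + 1) (K.src e) β →
      P i (K.tgt e) ((Path.Homotopic.Quotient.mk (edgePath e).symm).trans β))
    (β : Path.Homotopic.Quotient (pt w) c) (h : P p.word.length w β) :
    P 0 x ((edgeClass p).trans β) := by
  induction p generalizing P with
  | nil x =>
    rw [edgeClass_nil, Path.Homotopic.Quotient.refl_trans]
    exact h
  | fwd e p ih =>
    rw [edgeClass_fwd, Path.Homotopic.Quotient.trans_assoc]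
    refine hf 0 e rfl _ (ih (P := fun i => P (i + 1)) (fun i e' he => ?_) (fun i e' he => ?_) β h)
    · exact hf (i + 1) e' he
    · exact hb (i + 1) e' he
  | bwd e p ih =>
    rw [edgeClass_bwd, Path.Homotopic.Quotient.trans_assoc, ← Path.Homotopic.Quotient.mk_symm]
    refine hb 0 e rfl _ (ih (P := fun i => P (i + 1)) (fun i e' he => ?_) (fun i e' he => ?_) β h)
    · exact hf (i + 1) e' he
    · exact hb (i + 1) e' he

/-- Absorb the boundary arcs one by one, from the last to the first, into the radius ending at the
center. The boundary followed by a radius is then the same radius, which cancels. -/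
theorem edgeClass_bdry (f : K.F) : edgeClass (K.bdry f) = .refl (pt (K.base f)) := by
  let P : ℕ → ∀ u : K.V, Path.Homotopic.Quotient (pt u) (facePt f 0 0 0) → Prop := fun i u β =>
    ∃ κ : Path (pt u) (facePt f 0 0 0), (∀ s, κ s = facePt f i (σ s) 0) ∧ β = .mk κ
  have hlt : ∀ {i : ℕ} {a}, (K.bdry f).word[i]? = some a →
      ∃ h : i < (K.bdry f).word.length, (K.bdry f).word[i] = a :=
    fun h => List.getElem?_eq_some_iff.1 h
  have hn : ∀ {i : ℕ}, i < (K.bdry f).word.length → i < numArcs f :=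
    fun h => lt_of_lt_of_le h (le_max_right _ _)
  have h0 : facePt f 0 1 0 = pt (K.base f) := by
    rw [facePt_one f (numArcs_pos f), arcVal_zero edgePt_zero edgePt_one f (numArcs_pos f), corner,
      OrientedGraph.EdgePath.vert_zero]
  have hc : Continuous fun s : I => facePt f 0 (σ s) 0 :=
    (continuous_facePt f 0).comp (f := fun s : I => (σ s, (0 : I))) (by fun_prop)
  let κ0 : Path (pt (K.base f)) (facePt f 0 0 0) := ⟨⟨_, hc⟩, by simp [h0], by simp⟩
  -- The radius after the last arc is the initial one: the index equal to the number of arcs gives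
  -- the angle of index 0.
  have hend : P (K.bdry f).word.length (K.base f) (.mk κ0) := by
    refine ⟨κ0, fun s => ?_, rfl⟩
    change facePt f 0 (σ s) 0 = _
    rcases Nat.eq_zero_or_pos (K.bdry f).word.length with h | h
    · rw [h]
    · obtain ⟨m, hm⟩ : ∃ m, numArcs f = m + 1 := ⟨numArcs f - 1, by have := numArcs_pos f; omega⟩
      have hm' : m < numArcs f := by omega
      rw [← numArcs_eq h]
      unfold facePt
      conv_rhs => rw [show polar (numArcs f) (numArcs f) (σ s) 0 =
        polar (numArcs f) (m + 1) (σ s) 0 by rw [← hm], polar_succ_zero f hm',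
        polar_one_eq_zero (numArcs_pos f) hm', ← hm, Nat.mod_self]
  have key := edgeClass_trans_induction (P := P) (K.bdry f) (fun i e he β hβ => ?_)
    (fun i e he β hβ => ?_) _ hend
  · obtain ⟨κ, hκ, h⟩ := key
    obtain rfl : κ = κ0 := Path.ext (funext hκ)
    rw [← trans_trans_symm (edgeClass (K.bdry f)) (.mk κ0), h, Path.Homotopic.Quotient.trans_symm]
  · obtain ⟨hi, ha⟩ := hlt he
    obtain ⟨κ, hκ, rfl⟩ := hβ
    refine trans_radius f (hn hi) (edgePath e) (fun s => ?_) κ hκ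
    rw [facePt_one f (hn hi), arcVal, dif_pos hi, ha, if_pos rfl]
    rfl
  · obtain ⟨hi, ha⟩ := hlt he
    obtain ⟨κ, hκ, rfl⟩ := hβ
    refine trans_radius f (hn hi) (edgePath e).symm (fun s => ?_) κ hκ
    rw [facePt_one f (hn hi), arcVal, dif_pos hi, ha, if_neg (show ¬(-1 : ℤˣ) = 1 by decide)]
    rfl

/-! ### Connectivity -/

/-- Being joined to `x` by an edge path is constant on each closed cell, so it defines a nonempty
clopen subset of the space. -/
theorem exists_edgePath [ConnectedSpace K.Space] (x w : K.V) : Nonempty (K.EdgePath x w) := by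
  let rV : K.V → Prop := fun v => Nonempty (K.EdgePath x v)
  have step : ∀ {u u' : K.V} (_ : K.EdgePath u u'), rV u = rV u' := fun q =>
    propext ⟨fun ⟨p⟩ => ⟨p.append q⟩, fun ⟨p⟩ => ⟨p.append q.reverse⟩⟩
  have hs : ∀ e : K.E, rV (K.src e) = rV (K.tgt e) := fun e => step (.fwd e (.nil _))
  have hcorner : ∀ f : K.F, ∀ i ≤ numArcs f, rV (corner f i) = rV (K.base f) := by
    intro f i
    induction i with
    | zero =>
      intro _
      rw [corner, OrientedGraph.EdgePath.vert_zero]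
    | succ i ih =>
      intro hi
      obtain ⟨q, -⟩ := exists_edgeClass_arc f (i := i) hi
      rw [← step q, ih (by omega)]
  have hc : Compatible rV (fun e _ => rV (K.src e)) (fun f _ _ _ => rV (K.base f)) :=
    { src := fun e => rfl
      tgt := hs
      bdry := fun f i hi t => by
        rw [← hcorner f i hi.le, ← arcVal_zero (zE := fun e _ => rV (K.src e)) (fun _ => rfl) hs f hi]
        rfl
      rad := fun f i hi ρ => rfl
      cen := fun f i hi t => rfl }
  obtain ⟨g, hV, hE, hF⟩ := hc.exists_lift
  have h1 : IsOpen {y | g y} := isOpen_space (fun e => by simp [hE])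
    (fun f i hi => by simp [hF f i hi])
  have h2 : IsOpen {y | g y}ᶜ := isOpen_space (fun e => by simp [hE])
    (fun f i hi => by simp [hF f i hi])
  have h3 : {y | g y} = Set.univ := IsClopen.eq_univ ⟨⟨h2⟩, h1⟩
    ⟨pt x, by rw [Set.mem_ofPred_eq, hV]; exact ⟨.nil x⟩⟩
  have h4 : pt w ∈ {y | g y} := h3 ▸ Set.mem_univ _
  rwa [Set.mem_ofPred_eq, hV] at h4

/-! ### Holonomy of edge paths -/

section Hol

variable {G : Type*} [Group G]

theorem wordHol_append (φ : K.E → G) (l l' : List (K.E × ℤˣ)) :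
    wordHol φ (l ++ l') = wordHol φ l * wordHol φ l' := by
  simp [wordHol]

theorem wordHol_reverse (φ : K.E → G) {x w : K.V} (p : K.EdgePath x w) :
    wordHol φ p.reverse.word = (wordHol φ p.word)⁻¹ := by
  induction p with
  | nil x => simp [wordHol, OrientedGraph.EdgePath.reverse, OrientedGraph.EdgePath.word]
  | fwd e p ih =>
    rw [OrientedGraph.EdgePath.reverse, OrientedGraph.EdgePath.word_append, wordHol_append, ih]
    simp [wordHol, OrientedGraph.EdgePath.word]
  | bwd e p ih =>
    rw [OrientedGraph.EdgePath.reverse, OrientedGraph.EdgePath.word_append, wordHol_append, ih]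
    simp [wordHol, OrientedGraph.EdgePath.word]

theorem map_wordHol {G' : Type*} [Group G'] (g : G →* G') (φ : K.E → G) (l : List (K.E × ℤˣ)) :
    g (wordHol φ l) = wordHol (fun e => g (φ e)) l := by
  simp only [wordHol, map_list_prod, List.map_map]
  congr 2
  funext a
  simp

theorem exists_realizePath {x : K.V} (γ : PiOne K.Space (pt x)) :
    ∃ p : K.EdgePath x x, γ = PiOne.mk (realizePath p) := by
  obtain ⟨p, hp⟩ := exists_edgeClass (x := x) (v := x) γ.unop
  exact ⟨p, MulOpposite.unop_injective hp⟩

/-- A homomorphism on the fundamental group is, up to conjugation by elements assigned to the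
vertices, given by the holonomy of edges with trivial holonomy around every 2-cell. -/
theorem exists_edge_holonomy [ConnectedSpace K.Space] {x : K.V} (ρ : PiOne K.Space (pt x) →* G)
    (t : ∀ v, K.EdgePath x v) (s : K.V → G) :
    ∃ θ : K.E → G, (∀ f, wordHol θ (K.bdry f).word = 1) ∧ ∀ e, θ e =
      (s (K.src e))⁻¹ *
        ρ (PiOne.mk (realizePath (((t (K.src e)).append (.fwd e (.nil _))).append
          (t (K.tgt e)).reverse))) * s (K.tgt e) := by
  -- The extension of `ρ` from loops at `x` to the groupoid of paths between vertices: paths are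
  -- closed up by `t`, and values are conjugated by `s`.
  let ρ' : ∀ {u w : K.V}, Path.Homotopic.Quotient (pt u) (pt w) → G := fun {u w} β =>
    (s u)⁻¹ * ρ (MulOpposite.op (FundamentalGroup.fromPath
      (((edgeClass (t u)).trans β).trans (edgeClass (t w)).symm))) * s w
  have hmul : ∀ {u v w : K.V} (β : Path.Homotopic.Quotient (pt u) (pt v))
      (γ : Path.Homotopic.Quotient (pt v) (pt w)), ρ' (β.trans γ) = ρ' β * ρ' γ := by
    intro u v w β γ
    have h : (((edgeClass (t u)).trans (β.trans γ)).trans (edgeClass (t w)).symm) =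
        (((edgeClass (t u)).trans β).trans (edgeClass (t v)).symm).trans
          (((edgeClass (t v)).trans γ).trans (edgeClass (t w)).symm) := by
      simp only [← Path.Homotopic.Quotient.trans_assoc, trans_symm_trans]
    have h' : ρ (MulOpposite.op (FundamentalGroup.fromPath
        (((edgeClass (t u)).trans (β.trans γ)).trans (edgeClass (t w)).symm))) =
        ρ (MulOpposite.op (FundamentalGroup.fromPath
          (((edgeClass (t u)).trans β).trans (edgeClass (t v)).symm))) *
        ρ (MulOpposite.op (FundamentalGroup.fromPath
          (((edgeClass (t v)).trans γ).trans (edgeClass (t w)).symm))) := by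
      rw [h, ← map_mul]
      rfl
    simp only [ρ']
    rw [h']
    group
  have hrefl : ∀ u : K.V, ρ' (.refl (pt u)) = 1 := by
    intro u
    have h := hmul (.refl (pt u)) (.refl (pt u))
    rw [Path.Homotopic.Quotient.refl_trans] at h
    exact left_eq_mul.1 h
  let θ : K.E → G := fun e => ρ' (.mk (edgePath e))
  have hθ : ∀ {u w : K.V} (p : K.EdgePath u w), ρ' (edgeClass p) = wordHol θ p.word := by
    intro u w p
    induction p with
    | nil x =>
      rw [edgeClass_nil, hrefl]
      rfl
    | fwd e p ih =>
      rw [edgeClass_fwd, hmul, ih]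
      simp [wordHol, OrientedGraph.EdgePath.word, θ]
    | bwd e p ih =>
      have h : ρ' (Path.Homotopic.Quotient.mk (edgePath e)).symm = (θ e)⁻¹ := by
        rw [eq_inv_iff_mul_eq_one, ← hmul, Path.Homotopic.Quotient.symm_trans, hrefl]
      rw [edgeClass_bwd, hmul, ih, h]
      simp [wordHol, OrientedGraph.EdgePath.word]
  refine ⟨θ, fun f => ?_, fun e => ?_⟩
  · rw [← hθ, edgeClass_bdry, hrefl]
  · have h : PiOne.mk (realizePath (((t (K.src e)).append (.fwd e (.nil _))).append
        (t (K.tgt e)).reverse)) = MulOpposite.op (FundamentalGroup.fromPath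
          (((edgeClass (t (K.src e))).trans (.mk (edgePath e))).trans
            (edgeClass (t (K.tgt e))).symm)) := by
      rw [← edgeClass_reverse, ← edgeClass_edge, ← edgeClass_append, ← edgeClass_append]
      rfl
    rw [h]

end Hol

end CombinatorialComplex

/-! ### Powers of `ω` with exponents in `ZMod d` -/

section ZModPow

variable {G : Type*} [Monoid G] {g : G} {d : ℕ} [NeZero d]

theorem pow_val_add (hg : g ^ d = 1) (a b : ZMod d) :
    g ^ (a + b).val = g ^ a.val * g ^ b.val := by
  rw [ZMod.val_add, ← pow_add, ← pow_eq_pow_mod _ hg]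

theorem pow_val_sum {G : Type*} [CommMonoid G] {g : G} (hg : g ^ d = 1) {ι : Type*}
    (s : Finset ι) (a : ι → ZMod d) : g ^ (∑ i ∈ s, a i).val = ∏ i ∈ s, g ^ (a i).val := by
  classical
  induction s using Finset.induction_on with
  | empty => simp
  | insert i s hi ih => rw [Finset.sum_insert hi, Finset.prod_insert hi, pow_val_add hg, ih]

theorem pow_val_neg {G : Type*} [Group G] {g : G} (hg : g ^ d = 1) (a : ZMod d) :
    g ^ (-a).val = (g ^ a.val)⁻¹ := by
  rw [eq_inv_iff_mul_eq_one, ← pow_val_add hg]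
  simp

theorem zpow_eq_pow_val {G : Type*} [Group G] {g : G} (hg : g ^ d = 1) (k : ℤ) :
    g ^ k = g ^ ((k : ZMod d)).val := by
  rw [← zpow_natCast, ZMod.val_intCast, ← zpow_eq_zpow_emod' k hg]

theorem pow_val_units_mul {G : Type*} [Group G] {g : G} (hg : g ^ d = 1) (s : ℤˣ) (a : ZMod d) :
    g ^ (((s : ℤ) : ZMod d) * a).val = (g ^ a.val) ^ (s : ℤ) := by
  rcases Int.units_eq_one_or s with rfl | rfl
  · simp
  · simp [pow_val_neg hg]

theorem list_sum_map_neg {ι H : Type*} [AddCommGroup H] (l : List ι) (a : ι → H) :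
    (l.map fun i => -a i).sum = -(l.map a).sum := by
  induction l with
  | nil => simp
  | cons i l ih => simp only [List.map_cons, List.sum_cons, ih, neg_add]

end ZModPow

theorem rootOmega_isPrimitiveRoot {d : ℕ} (hd : d ≠ 0) : IsPrimitiveRoot (rootOmega d) d :=
  Complex.isPrimitiveRoot_exp d hd

theorem scalarOmega_pow_coe (d n k : ℕ) :
    ((scalarOmega d n ^ k : Matrix.unitaryGroup (Fin n) ℂ) : Matrix (Fin n) (Fin n) ℂ) =
      Matrix.scalar (Fin n) (rootOmega d ^ k) := by
  rw [map_pow]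
  rfl

theorem scalarOmega_pow_card {d : ℕ} (hd : d ≠ 0) (n : ℕ) : scalarOmega d n ^ d = 1 := by
  apply Subtype.ext
  rw [scalarOmega_pow_coe, (rootOmega_isPrimitiveRoot hd).pow_eq_one, map_one]
  rfl

theorem rootOmega_pow_val_injective {d : ℕ} [NeZero d] :
    Function.Injective fun a : ZMod d => rootOmega d ^ a.val := by
  intro a b h
  exact ZMod.val_injective d ((rootOmega_isPrimitiveRoot (NeZero.ne d)).pow_inj (ZMod.val_lt a)
    (ZMod.val_lt b) h)

/-- Since n ≥ 1 there is a diagonal entry to compare. -/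
theorem scalarOmega_pow_val_injective {d n : ℕ} [NeZero d] (hn : 1 ≤ n) :
    Function.Injective fun a : ZMod d => scalarOmega d n ^ a.val := by
  intro a b h
  have h1 := congrArg Subtype.val h
  dsimp only at h1
  rw [scalarOmega_pow_coe, scalarOmega_pow_coe] at h1
  have h2 := congrFun (congrFun h1 ⟨0, hn⟩) ⟨0, hn⟩
  simp only [Matrix.scalar_apply, Matrix.diagonal_apply_eq] at h2
  exact rootOmega_pow_val_injective h2

/-! ### Lifts and classical realizations -/

namespace SignedArrangement

variable {L : Type u} (A : SignedArrangement L)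

/-- A classical realization is a solution of a system of linear equations over `ZMod d`. -/
theorem isClassicalRealization_iff {d : ℕ} [NeZero d] (τ : A.Context → ZMod d) (c : L → ZMod d) :
    A.IsClassicalRealization τ c ↔
      ∀ C, ((A.order C).map fun a => ((A.sign C a : ℤ) : ZMod d) * c a).sum = τ C := by
  classical
  refine forall_congr' fun C => ?_
  have h : C.1 = (A.order C).toFinset := by
    ext a
    rw [List.mem_toFinset, A.mem_order]
  rw [← pow_val_sum (rootOmega_isPrimitiveRoot (NeZero.ne d)).pow_eq_one,
    rootOmega_pow_val_injective.eq_iff, ← List.sum_toFinset _ (A.order_nodup C), ← h]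

/-- Multiplying the operators by powers of `ω` multiplies the operators of contexts by powers
of `ω`. -/
theorem prod_scalarOmega_mul {d n : ℕ} [NeZero d] (T : L → Matrix.unitaryGroup (Fin n) ℂ)
    (k : L → ZMod d) (s : L → ℤˣ) (l : List L) :
    (l.map fun a => (scalarOmega d n ^ (k a).val * T a) ^ (s a : ℤ)).prod =
      scalarOmega d n ^ ((l.map fun a => ((s a : ℤ) : ZMod d) * k a).sum).val *
        (l.map fun a => T a ^ (s a : ℤ)).prod := by
  have hg := scalarOmega_pow_card (NeZero.ne d) n
  have hcomm : ∀ (m : ℕ) (U : Matrix.unitaryGroup (Fin n) ℂ), Commute (scalarOmega d n ^ m) U :=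
    fun m U => Commute.pow_left (scalarOmega_mul_comm d n U) m
  induction l with
  | nil => simp
  | cons a l ih =>
    simp only [List.map_cons, List.prod_cons, List.sum_cons]
    rw [ih, pow_val_add hg, pow_val_units_mul hg, (hcomm _ _).mul_zpow]
    have h := hcomm ((l.map fun a => ((s a : ℤ) : ZMod d) * k a).sum).val (T a ^ (s a : ℤ))
    simp only [mul_assoc]
    congr 1
    rw [← mul_assoc, ← h.eq, mul_assoc]

namespace TopologicalRealization

variable {A} (X : A.TopologicalRealization)

/-- The context of a 2-cell. -/
def context (f : X.complex.F) : A.Context := X.toSing.onF f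

theorem map_bdry_word (f : X.complex.F) :
    (X.complex.bdry f).word.map (fun a => (X.label a.1, a.2)) =
      (A.order (X.context f)).map fun a => (a, A.sign (X.context f) a) := by
  have h := X.toSing.map_bdry f
  rw [show (A.sing.bdry (X.toSing.onF f)).word = _ from word_singPath _] at h
  exact h.symm

/-- The labelling preserves boundary words, so the holonomy of operators around a 2-cell is the
product in the relation of its context. -/
theorem wordHol_bdry {G : Type*} [Group G] (T : L → G) (f : X.complex.F) :
    CombinatorialComplex.wordHol (fun e => T (X.label e)) (X.complex.bdry f).word =
      ((A.order (X.context f)).map fun a => T a ^ (A.sign (X.context f) a : ℤ)).prod := by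
  have h := congrArg (fun l => (l.map fun a : L × ℤˣ => T a.1 ^ (a.2 : ℤ)).prod)
    (X.map_bdry_word f)
  simp only [List.map_map] at h
  exact h

theorem pathOperator_eq_wordHol {n : ℕ} (T : L → Matrix.unitaryGroup (Fin n) ℂ)
    {x w : X.complex.V} (p : X.complex.EdgePath x w) :
    X.pathOperator T p = CombinatorialComplex.wordHol (fun e => T (X.label e)) p.word := rfl

/-- Rescaling each operator by ω^{-c(a)} cancels τ in every context relation and does not change its
class modulo ω. -/
theorem exists_lift_of_classical {d n : ℕ} [NeZero d] {τ : A.Context → ZMod d}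
    {T : L → Matrix.unitaryGroup (Fin n) ℂ} (hT : A.IsOperatorRealization τ T)
    {x : X.complex.V} {π : X.fundGroup x →* Matrix.unitaryGroup (Fin n) ℂ ⧸ omegaSubgroup d n}
    (hπ : X.IsInducedRep d T x π) {c : L → ZMod d} (hc : A.IsClassicalRealization τ c) :
    ∃ ρ : X.fundGroup x →* Matrix.unitaryGroup (Fin n) ℂ,
      (QuotientGroup.mk' (omegaSubgroup d n)).comp ρ = π := by
  have hg := scalarOmega_pow_card (NeZero.ne d) n
  have hc' := (A.isClassicalRealization_iff τ c).1 hc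
  obtain ⟨ρ, hρ⟩ := CombinatorialComplex.exists_holonomy (K := X.complex)
    (φ := fun e => scalarOmega d n ^ (-c (X.label e)).val * T (X.label e)) (fun f => by
      rw [X.wordHol_bdry (fun a => scalarOmega d n ^ (-c a).val * T a),
        prod_scalarOmega_mul T (fun a => -c a) (A.sign (X.context f)), hT.2,
        ← pow_val_add hg, ← hc']
      simp [list_sum_map_neg]) x
  refine ⟨ρ, ?_⟩
  ext γ
  obtain ⟨p, rfl⟩ := CombinatorialComplex.exists_realizePath γ
  rw [hπ p, MonoidHom.comp_apply, hρ, pathOperator_eq_wordHol, CombinatorialComplex.map_wordHol,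
    CombinatorialComplex.map_wordHol]
  congr 1
  funext e
  have h : QuotientGroup.mk' (omegaSubgroup d n)
      (scalarOmega d n ^ (-c (X.label e)).val) = 1 :=
    (QuotientGroup.eq_one_iff _).2 (Subgroup.pow_mem _ (Subgroup.mem_zpowers _) _)
  rw [map_mul, h, one_mul]

/-- The lift, spread over edges by `exists_edge_holonomy`, differs from the operators by powers of
ω, and its trivial boundary holonomy is a linear system for the exponents. -/
theorem exists_classical_of_lift {d n : ℕ} [NeZero d] (hn : 1 ≤ n) {τ : A.Context → ZMod d}
    {T : L → Matrix.unitaryGroup (Fin n) ℂ} (hT : A.IsOperatorRealization τ T)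
    {x : X.complex.V} {π : X.fundGroup x →* Matrix.unitaryGroup (Fin n) ℂ ⧸ omegaSubgroup d n}
    (hπ : X.IsInducedRep d T x π) {ρ : X.fundGroup x →* Matrix.unitaryGroup (Fin n) ℂ}
    (hρ : (QuotientGroup.mk' (omegaSubgroup d n)).comp ρ = π) :
    ∃ c : L → ZMod d, A.IsClassicalRealization τ c := by
  have hg := scalarOmega_pow_card (NeZero.ne d) n
  have := X.connected
  let t : ∀ v, X.complex.EdgePath x v := fun v => (CombinatorialComplex.exists_edgePath x v).some
  obtain ⟨θ, hθ, hθe⟩ := CombinatorialComplex.exists_edge_holonomy ρ t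
    -- Conjugating by the operators of the chosen paths makes θ(e) telescope to the class of the
    -- operator of e.
    (fun v => X.pathOperator T (t v))
  have hk : ∀ e, ∃ k : ZMod d, θ e = scalarOmega d n ^ k.val * T (X.label e) := by
    intro e
    have h1 : QuotientGroup.mk' (omegaSubgroup d n) (T (X.label e)) =
        QuotientGroup.mk' (omegaSubgroup d n) (θ e) := by
      rw [hθe, map_mul, map_mul, ← MonoidHom.comp_apply, hρ, hπ, ← map_mul, ← map_mul]
      congr 1
      simp only [pathOperator_eq_wordHol, OrientedGraph.EdgePath.word_append,
        CombinatorialComplex.wordHol_append, CombinatorialComplex.wordHol_reverse]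
      simp only [CombinatorialComplex.wordHol, OrientedGraph.EdgePath.word, List.map_cons,
        List.map_nil, List.prod_cons, List.prod_nil, Units.val_one, zpow_one]
      group
    obtain ⟨j, hj⟩ := QuotientGroup.eq.1 h1
    refine ⟨(j : ZMod d), ?_⟩
    dsimp only at hj
    rw [← zpow_eq_pow_val hg,
      (Commute.zpow_left (show Commute _ _ from scalarOmega_mul_comm d n _) j).eq, hj,
      mul_inv_cancel_left]
  choose k hk using hk
  let lab := Equiv.ofBijective _ X.bijective_onE
  have hlab : ∀ e, lab.symm (X.label e) = e := fun e => lab.symm_apply_apply e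
  -- Bijectivity on edges turns `k` into a function of labels. The sign is negative because the
  -- boundary relation says that the signed sum of `k` plus `τ` vanishes.
  refine ⟨fun a => -k (lab.symm a), (A.isClassicalRealization_iff τ _).2 fun C => ?_⟩
  obtain ⟨f, hf⟩ := X.bijective_onF.2 C
  obtain rfl : X.context f = C := hf
  have h2 : θ = fun e => scalarOmega d n ^ (k (lab.symm (X.label e))).val * T (X.label e) := by
    funext e
    rw [hlab, hk]
  have h3 := hθ f
  rw [h2, X.wordHol_bdry (fun a => scalarOmega d n ^ (k (lab.symm a)).val * T a),
    prod_scalarOmega_mul T (fun a => k (lab.symm a)) (A.sign (X.context f)), hT.2,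
    ← pow_val_add hg] at h3
  have h4 := scalarOmega_pow_val_injective (d := d) hn (h3.trans
    (by simp : 1 = scalarOmega d n ^ (0 : ZMod d).val))
  simp only [mul_neg, list_sum_map_neg]
  exact neg_eq_of_add_eq_zero_right h4

end TopologicalRealization

end SignedArrangement

/-! ### The theorem -/

theorem mainTheorem2 {L : Type u} [Finite L] (A : SignedArrangement L) (d : ℕ) (hd : 2 ≤ d)
    (τ : A.Context → ZMod d) (n : ℕ) (hn : 1 ≤ n)
    (T : L → Matrix.unitaryGroup (Fin n) ℂ) (hT : A.IsOperatorRealization τ T)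
    (X : SignedArrangement.TopologicalRealization.{u, v} A) (x : X.complex.V) :
    (∃! π : X.fundGroup x →* Matrix.unitaryGroup (Fin n) ℂ ⧸ omegaSubgroup d n,
      X.IsInducedRep d T x π) ∧
    ∀ π : X.fundGroup x →* Matrix.unitaryGroup (Fin n) ℂ ⧸ omegaSubgroup d n,
      X.IsInducedRep d T x π →
        ((∃ c : L → ZMod d, A.IsClassicalRealization τ c) ↔
          ∃ ρ : X.fundGroup x →* Matrix.unitaryGroup (Fin n) ℂ,
            (QuotientGroup.mk' (omegaSubgroup d n)).comp ρ = π) := by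
  have : NeZero d := ⟨by omega⟩
  refine ⟨?_, fun π hπ => ⟨fun ⟨c, hc⟩ => X.exists_lift_of_classical hT hπ hc,
    fun ⟨ρ, hρ⟩ => X.exists_classical_of_lift hn hT hπ hρ⟩⟩
  -- In the quotient the powers of ω on the right of the context relations become trivial.
  obtain ⟨π, hπ⟩ := CombinatorialComplex.exists_holonomy (K := X.complex)
    (φ := fun e => QuotientGroup.mk' (omegaSubgroup d n) (T (X.label e))) (fun f => by
      rw [← CombinatorialComplex.map_wordHol, X.wordHol_bdry T, hT.2]
      exact (QuotientGroup.eq_one_iff _).2 (Subgroup.pow_mem _ (Subgroup.mem_zpowers _) _)) x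
  refine ⟨π, fun p => ?_, fun π' hπ' => ?_⟩
  · rw [hπ, X.pathOperator_eq_wordHol, CombinatorialComplex.map_wordHol]
  -- Every class is that of an edge loop, where the value is prescribed.
  · ext γ
    obtain ⟨p, rfl⟩ := CombinatorialComplex.exists_realizePath γ
    rw [hπ, hπ' p, X.pathOperator_eq_wordHol, CombinatorialComplex.map_wordHol]
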